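/- **Setting.** Let $K\ge 2$, let $\nu_1,\dots,\nu_K$ be probability distributions on $[0,1]$ with means satisfying $0<\mu_K\le\dots\le\mu_2<\mu_1<1$, and put $\Delta_k=\mu_1-\mu_k$. For each arm $k$ let $X_{k,1},X_{k,2},\dots$ be i.i.d. with law $\nu_k$. At each time $t\ge 1$ a leader broadcasts an arm $A_t$, chosen as a function of the bits received so far; follower $A_t$ observes its next reward $X_{A_t,T_{A_t}(t)}$, where $T_k(t)$ is the number of broadcasts of $k$ up to time $t$, and sends one bit $M_{A_t,T_{A_t}(t)}$. The regret is $R_n=\sum_{t=1}^n\mathbb E[\mu_1-\mu_{A_t}]$. **Message policy.** Let $\tau(i)=1+(i+1)\lceil\log_2(i+1)\rceil-2^{\lceil\log_2(i+1)\rceil}$ and $\iota(s)=\max\{i\ge 0:\tau(i)\le s\}$ for integers $i,s\ge 0$, let $\Gamma_\alpha(x)=\lceil 2^\alpha x\rceil-1$ for $x\in(0,1]$ and $\Gamma_\alpha(0)=0$, and let $\hat\mu_{k,m}=\frac1m\sum_{i=1}^m X_{k,i}$. The $s$-th bit of follower $k$ is $$M_{k,s}=\Gamma_{s-\tau(\iota(s-1))}\big(\hat\mu_{k,1+\tau(\iota(s-1))}\big)-2\,\Gamma_{s-\tau(\iota(s-1))-1}\big(\hat\mu_{k,1+\tau(\iota(s-1))}\big)\in\{0,1\}.$$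 **Arm policy (KL-UCB variant).** For $p,q\in[0,1]$ let $d(p,q)=p\log\frac pq+(1-p)\log\frac{1-p}{1-q}$ (with $0\log 0=0\log\frac00=0$, $r\log\frac r0=\infty$ for $r>0$), $f(t)=1+t(\log t)^2$, and $g_t(x,s)=\max\{y\in[0,1]: d(x,y)\le \log f(t)/s\}$. With $\eta(s)=1+\tau(\iota(s)-1)$ and $$\bar\mu_{k,s}=\sum_{s'=1+\tau(\iota(s)-1)}^{\tau(\iota(s))}2^{\tau(\iota(s)-1)-s'}M_{k,s'}+2^{\tau(\iota(s)-1)-\tau(\iota(s))},$$ the leader broadcasts $A_t=t$ for $t\le K$ and $A_t\in\arg\max_k g_t\big(\bar\mu_{k,T_k(t-1)},\eta(T_k(t-1))\big)$ for $t>K$, ties being broken arbitrarily. **Statement.** For $n\ge 2$ let $C_n=2+(\log n)^{1/3}$ and $$L_k(n)=\frac{\big(\frac1{\mu_k}+\frac1{1-\mu_1}\big)^2\log f(n)}{C_n\Delta_k\big(2-\frac1{C_n}\big)^2}+\frac{10\,C_n^2}{\Delta_k}+\frac{13\Delta_k}{4}\log_2\!\left(\max\left\{\left\lceil\frac{\log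 f(n)}{2\Delta_k^2(1-\frac2{C_n})^2}\right\rceil,\frac{4C_n^2}{\Delta_k^2}\right\}\right).$$ Then for every $n\ge 2$ $$R_n\le\sum_{k=2}^K\left(\frac{\Delta_k\log f(n)}{d(\mu_k,\mu_1)}+L_k(n)\right),$$ and $\sum_{k=2}^K L_k(n)=O\big(K(\log n)^{2/3}/\Delta_2\big)$ in the following sense: there is an absolute constant $c$ such that, for all instances and all $n\ge2$, $$\Big|\sum_{k=2}^K L_k(n)\Big|\le c\,\Big(\frac1{\mu_K}+\frac1{1-\mu_1}\Big)^2\,\frac{K(\log n)^{2/3}}{\Delta_2}.$$ Moreover, for every $k\ge2$ and $n\ge2$, $$d(\mu_k,\mu_1)-d\Big(\mu_k+\frac{\Delta_k}{C_n},\,\mu_1-\frac{\Delta_k}{C_n}\Big)\le\frac{\Delta_k^2}{C_n}\Big(\frac1{\mu_k}+\frac1{1-\mu_1}\Big)^2 .$$ -/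

import Mathlib

open MeasureTheory ProbabilityTheory

noncomputable section

namespace OneBitBandit

/-! ### The leader-follower bandit game with one-bit messages -/

/-- A message policy: the `s`-th bit sent by a follower, as a function of the `s` rewards
it has observed so far (`x i` is its `(i+1)`-th reward). -/
abbrev MessagePolicy : Type := (s : ℕ) → (Fin s → ℝ) → Bool

/-- An arm policy: at time `t ≥ 1`, when arm `k` has been broadcast `T k` times, the leader sees
the bits `b k i` (the `(i+1)`-th bit received from follower `k`, `i < T k`) and chooses an arm. -/
abbrev ArmPolicy (K : ℕ) : Type :=
  (t : ℕ) → (T : Fin K → ℕ) → ((k : Fin K) → Fin (T k) → Bool) → Fin K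

/-- The arm broadcast at time `t` when arm `k` has been pulled `T k` times and its rewards are
`x k 0, x k 1, …`. -/
def step {K : ℕ} (πa : ArmPolicy K) (πm : MessagePolicy) (x : Fin K → ℕ → ℝ)
    (t : ℕ) (T : Fin K → ℕ) : Fin K :=
  πa t T (fun k i => πm (i.val + 1) (fun j => x k j.val))

/-- `pulls πa πm x t k` is the number of broadcasts of arm `k` in the rounds `1, …, t`. -/
def pulls {K : ℕ} (πa : ArmPolicy K) (πm : MessagePolicy) (x : Fin K → ℕ → ℝ) :
    ℕ → Fin K → ℕ
  | 0 => fun _ => 0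
  | t + 1 => fun k =>
      pulls πa πm x t k + if step πa πm x (t + 1) (pulls πa πm x t) = k then 1 else 0

/-- The arm `A_t` broadcast at time `t ≥ 1`. -/
def armAt {K : ℕ} (πa : ArmPolicy K) (πm : MessagePolicy) (x : Fin K → ℕ → ℝ) (t : ℕ) : Fin K :=
  step πa πm x t (pulls πa πm x (t - 1))

/-- The regret `R_n(πa, πm) = ∑_{t=1}^n E[max_k μ_k - μ_{A_t}]`, where `X k i` is the `(i+1)`-th
reward of arm `k`. -/
def regret {K : ℕ} {Ω : Type*} [MeasurableSpace Ω] (P : Measure Ω) (X : Fin K → ℕ → Ω → ℝ)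
    (μ : Fin K → ℝ) (πa : ArmPolicy K) (πm : MessagePolicy) (n : ℕ) : ℝ :=
  ∑ t ∈ Finset.Icc 1 n,
    ∫ ω, ((⨆ k, μ k) - μ (armAt πa πm (fun k i => X k i ω) t)) ∂P

/-! ### The packet schedule -/

/-- `τ(i) = 1 + (i+1)⌈log₂(i+1)⌉ - 2^⌈log₂(i+1)⌉`: the number of pulls at which the `i`-th packet
is complete. -/
def tau (i : ℕ) : ℕ := 1 + (i + 1) * Nat.clog 2 (i + 1) - 2 ^ Nat.clog 2 (i + 1)

/-- `ι(s) = max {i : τ(i) ≤ s}`: the number of packets transmitted after `s` pulls. -/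
def iota (s : ℕ) : ℕ := sSup {i : ℕ | tau i ≤ s}

/-- `η(s) = 1 + τ(ι(s) - 1)`: the number of samples behind the most recent complete packet. -/
def eta (s : ℕ) : ℕ := 1 + tau (iota s - 1)

theorem le_tau (i : ℕ) : i ≤ tau i := by
  rcases lt_or_ge i 4 with h | h
  · interval_cases i <;> decide
  · have h3 : 3 ≤ Nat.clog 2 (i + 1) := by
      have : Nat.clog 2 5 ≤ Nat.clog 2 (i + 1) := Nat.clog_mono_right 2 (by omega)
      have h5 : Nat.clog 2 5 = 3 := by decide
      omega
    have h1 : 2 ^ (Nat.clog 2 (i + 1) - 1) < i + 1 := by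
      have := Nat.pow_pred_clog_lt_self (b := 2) (by norm_num) (x := i + 1) (by omega)
      simpa using this
    have h2 : 2 ^ Nat.clog 2 (i + 1) = 2 * 2 ^ (Nat.clog 2 (i + 1) - 1) := by
      conv_lhs => rw [show Nat.clog 2 (i + 1) = (Nat.clog 2 (i + 1) - 1) + 1 by omega]
      rw [pow_succ]; ring
    have h4 : (i + 1) * 3 ≤ (i + 1) * Nat.clog 2 (i + 1) := Nat.mul_le_mul_left _ h3
    unfold tau
    omega

/-- The maximum defining `ι(s)` exists. -/
theorem iota_isGreatest (s : ℕ) : IsGreatest {i : ℕ | tau i ≤ s} (iota s) := by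
  have hb : BddAbove {i : ℕ | tau i ≤ s} := ⟨s, fun i hi => (le_tau i).trans hi⟩
  have hn : {i : ℕ | tau i ≤ s}.Nonempty := ⟨0, by
    have : tau 0 = 0 := by decide
    simp [this]⟩
  exact ⟨Nat.sSup_mem hn hb, fun i hi => le_csSup hb hi⟩

/-! ### The message policy -/

/-- `Γ_α(x) = ⌈2^α x⌉ - 1` for `x ∈ (0,1]` and `Γ_α(0) = 0`. -/
def Gam (α : ℕ) (x : ℝ) : ℤ := if x = 0 then 0 else ⌈2 ^ α * x⌉ - 1

/-- The difference of consecutive quantizations is a bit. -/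
theorem Gam_bit (α : ℕ) (x : ℝ) :
    Gam (α + 1) x - 2 * Gam α x = 0 ∨ Gam (α + 1) x - 2 * Gam α x = 1 := by
  unfold Gam
  by_cases hx : x = 0
  · simp [hx]
  · simp only [hx, if_false]
    have e : (2 : ℝ) ^ (α + 1) * x = 2 * (2 ^ α * x) := by ring
    rw [e]
    generalize (2 : ℝ) ^ α * x = y
    have h1 : ⌈2 * y⌉ ≤ 2 * ⌈y⌉ := by
      rw [Int.ceil_le]; push_cast; linarith [Int.le_ceil y]
    have h2 : 2 * ⌈y⌉ - 2 < ⌈2 * y⌉ := by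
      rw [Int.lt_ceil]; push_cast; linarith [Int.ceil_lt_add_one y]
    omega

/-- The empirical mean of the first `m` of the observed rewards `x 0, …, x (s-1)`, `1 ≤ m ≤ s`. -/
def empMean {s : ℕ} (x : Fin s → ℝ) (m : ℕ) : ℝ :=
  (∑ i : Fin s with i.val < m, x i) / m

/-- The message policy: the `s`-th bit (`s ≥ 1`) is
`Γ_{s - τ(ι(s-1))}(μ̂) - 2 Γ_{s - τ(ι(s-1)) - 1}(μ̂)`, where `μ̂` is the empirical mean of the first
`1 + τ(ι(s-1)) ≤ s` rewards. This integer is `0` or `1` (`Gam_bit`); `true` stands for `1`. -/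
def packetPolicy : MessagePolicy := fun s x =>
  decide (Gam (s - tau (iota (s - 1))) (empMean x (1 + tau (iota (s - 1))))
    - 2 * Gam (s - tau (iota (s - 1)) - 1) (empMean x (1 + tau (iota (s - 1)))) = 1)

/-! ### The arm policy -/

/-- The leader's estimate of the mean of an arm, computed from the `s ≥ 1` bits received from it:
`∑_{s' = 1 + τ(ι(s)-1)}^{τ(ι(s))} 2^{τ(ι(s)-1) - s'} M_{s'} + 2^{τ(ι(s)-1) - τ(ι(s))}`
(the bit `b i` is `M_{i+1}`). -/
def decode {s : ℕ} (b : Fin s → Bool) : ℝ :=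
  (∑ i : Fin s with tau (iota s - 1) < i.val + 1 ∧ i.val + 1 ≤ tau (iota s),
      (2 : ℝ) ^ ((tau (iota s - 1) : ℤ) - (i.val + 1 : ℤ)) * ((b i).toNat : ℝ))
    + (2 : ℝ) ^ ((tau (iota s - 1) : ℤ) - (tau (iota s) : ℤ))

/-- `πa` is an arm policy with decision functions `g`: round robin in the rounds `1, …, K`, then a
maximizer of `g_t(μ̄_k, η(T_k(t-1)))`, ties being broken arbitrarily. -/
def IsIndexPolicy {K : ℕ} (g : ℕ → ℝ → ℕ → ℝ) (πa : ArmPolicy K) : Prop :=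
  ∀ (t : ℕ) (T : Fin K → ℕ) (b : (k : Fin K) → Fin (T k) → Bool), 1 ≤ t →
    (t ≤ K → (πa t T b).val + 1 = t) ∧
    (K < t → ∀ k, g t (decode (b k)) (eta (T k))
      ≤ g t (decode (b (πa t T b))) (eta (T (πa t T b))))

/-! ### The KL-UCB decision function -/

/-- `f(t) = 1 + t (log t)²`. -/
def f (t : ℕ) : ℝ := 1 + t * Real.log t ^ 2

/-- `p log (p / q)` with `0 log 0 = 0 log (0/0) = 0` and `p log (p / 0) = ∞` for `p > 0`. -/
def klTerm (p q : ℝ) : EReal :=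
  if p = 0 then 0 else if q = 0 then ⊤ else ((p * Real.log (p / q) : ℝ) : EReal)

/-- The Bernoulli Kullback-Leibler divergence on `[0,1]²`, with values in `[0,∞]`. -/
def d (p q : ℝ) : EReal := klTerm p q + klTerm (1 - p) (1 - q)

/-- `g_t(x,s) = max {y ∈ [0,1] : d(x,y) ≤ log f(t) / s}` for `s ≥ 1`. -/
def gKL (t : ℕ) (x : ℝ) (s : ℕ) : ℝ :=
  sSup {y : ℝ | y ∈ Set.Icc (0 : ℝ) 1 ∧ d x y ≤ ((Real.log (f t) / s : ℝ) : EReal)}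

/-! ### Quantities in the regret bound -/

/-- `C_n = 2 + (log n)^{1/3}`. -/
def C (n : ℕ) : ℝ := 2 + Real.log n ^ (1 / 3 : ℝ)

/-- The lower-order terms for an arm with mean `q` when the best mean is `p`; the gap is `p - q`. -/
def lowerOrder (p q : ℝ) (n : ℕ) : ℝ :=
  (1 / q + 1 / (1 - p)) ^ 2 * Real.log (f n) / (C n * (p - q) * (2 - 1 / C n) ^ 2)
    + 10 * C n ^ 2 / (p - q)
    + 13 * (p - q) / 4 *
        Real.logb 2 (max (⌈Real.log (f n) / (2 * (p - q) ^ 2 * (1 - 2 / C n) ^ 2)⌉ : ℝ)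
          (4 * C n ^ 2 / (p - q) ^ 2))

end OneBitBandit

end

open Filter Topology

namespace OneBitBandit

/-! Only two properties of the message scheme matter. The leader's estimate is never below the mean
of the `eta s` samples behind it and exceeds it by at most `1 / (iota s + 1)` (`decode_bounds`). The
delay is mild: `s ≤ 2 * eta s`, and `eta s ≤ U` keeps `s` within a logarithm of `U`
(`le_two_mul_eta`, `le_of_eta_le`). Since rounding goes upwards it preserves optimism, so the best
arm can be analysed through its unquantized means.

For a suboptimal arm with mean `q` and gap `Δ`, let `ε = Δ / C n`, `δ = ε / 2`, `y = μ₁ - ε`.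
Pathwise, `pulls_le` charges each pull after the round robin either to a round in which the best
index may fall below `y`, or to a pull count `s` with too few samples (`eta s ≤ U = log f(n) / kl (q
+ ε) y`), too coarse a packet, or an empirical mean above `q + δ`. The first cause has probability
of order `1 / (f t * ε ^ 2)`: the margin between `y` and `μ₁` adds a geometric factor in `s` to
Chernoff's bound (`prob_lt_kl_prefixMean`), so a plain union bound over `s` suffices, and `1 / f` is
summable. The others contribute `U` plus a logarithm, and two terms of order `1 / δ ^ 2`, the last
by Hoeffding.

Replacing `U` by `log f(n) / d(q, μ₁)` costs, by `kl_sub_kl_le` and Pinsker, a term of order `log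
f(n) / C n`, against `(C n) ^ 2` for the deviations; the cube root in `C n` balances the two. -/

/-! ### Packet lengths and delay -/

theorem tau_succ (i : ℕ) : tau (i + 1) = tau i + Nat.clog 2 (i + 2) := by
  have hle : i + 1 ≤ 2 ^ Nat.clog 2 (i + 1) := Nat.le_pow_clog (by norm_num) _
  have hbound : 2 ^ Nat.clog 2 (i + 1) ≤ 1 + (i + 1) * Nat.clog 2 (i + 1) := by
    rcases Nat.eq_zero_or_pos i with rfl | hi
    · decide
    · have h1 : 2 ^ (Nat.clog 2 (i + 1) - 1) < i + 1 := by
        simpa using Nat.pow_pred_clog_lt_self (b := 2) (by norm_num) (x := i + 1) (by omega)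
      have hc : 1 ≤ Nat.clog 2 (i + 1) := Nat.clog_pos (by norm_num) (by omega)
      obtain ⟨c, hc'⟩ : ∃ c, Nat.clog 2 (i + 1) = c + 1 := ⟨_, (Nat.sub_add_cancel hc).symm⟩
      rw [hc'] at h1 ⊢
      simp only [Nat.add_sub_cancel] at h1
      rw [pow_succ]
      rcases Nat.eq_zero_or_pos c with rfl | hc0
      · simp; omega
      · nlinarith
  have hmono : Nat.clog 2 (i + 1) ≤ Nat.clog 2 (i + 2) := Nat.clog_mono_right 2 (by omega)
  unfold tau
  rw [show i + 1 + 1 = i + 2 by ring]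
  -- The logarithm jumps only when `i + 1` is a power of two, and then the doubling of the
  -- subtracted power absorbs the surplus. `hbound` keeps the truncated subtraction exact.
  by_cases h : i + 2 ≤ 2 ^ Nat.clog 2 (i + 1)
  · have h2 : Nat.clog 2 (i + 2) = Nat.clog 2 (i + 1) :=
      le_antisymm ((Nat.clog_le_iff_le_pow (by norm_num)).2 h) hmono
    rw [h2, show (i + 2) * Nat.clog 2 (i + 1)
      = (i + 1) * Nat.clog 2 (i + 1) + Nat.clog 2 (i + 1) by ring]
    omega
  · have h3 : i + 1 = 2 ^ Nat.clog 2 (i + 1) := by omega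
    have h2 : Nat.clog 2 (i + 2) = Nat.clog 2 (i + 1) + 1 := by
      apply le_antisymm
      · rw [Nat.clog_le_iff_le_pow (by norm_num), pow_succ]; omega
      · by_contra hlt
        exact h ((Nat.clog_le_iff_le_pow (by norm_num)).1 (by omega))
    rw [h2]
    generalize Nat.clog 2 (i + 1) = c at *
    rw [show i + 2 = 2 ^ c + 1 by omega, h3, pow_succ]
    have : (2 ^ c + 1) * (c + 1) = 2 ^ c * c + 2 ^ c + c + 1 := by ring
    rw [← h3] at *
    omega

theorem tau_zero : tau 0 = 0 := by decide

theorem tau_mono : Monotone tau :=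
  monotone_nat_of_le_succ fun i => by rw [tau_succ]; omega

theorem tau_iota_le (s : ℕ) : tau (iota s) ≤ s := (iota_isGreatest s).1

theorem lt_tau_iota_succ (s : ℕ) : s < tau (iota s + 1) := by
  by_contra h
  have := (iota_isGreatest s).2 (show iota s + 1 ∈ {i : ℕ | tau i ≤ s} by simpa using h)
  omega

theorem iota_eq_of_mem {j i : ℕ} (h1 : tau j ≤ i) (h2 : i < tau (j + 1)) : iota i = j := by
  apply le_antisymm
  · by_contra h
    have := tau_mono (show j + 1 ≤ iota i by omega)
    have := tau_iota_le i
    omega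
  · exact (iota_isGreatest i).2 h1

theorem one_le_iota {s : ℕ} (hs : 1 ≤ s) : 1 ≤ iota s :=
  (iota_isGreatest s).2 (by
    have : tau 1 = 1 := by decide
    simpa [this] using hs)

theorem two_mul_tau_le (i : ℕ) : 2 * tau i ≤ i * (i + 1) := by
  induction i with
  | zero => simp [tau_zero]
  | succ i ih =>
    have : Nat.clog 2 (i + 2) ≤ i + 1 := by
      rw [Nat.clog_le_iff_le_pow (by norm_num)]
      have := Nat.lt_two_pow_self (n := i + 1)
      omega
    rw [tau_succ]
    nlinarith

/-- By induction on the increments: `j + 4 ≤ (j + 2) ^ 2`, so the packet two places later is at most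
twice as long. -/
theorem tau_add_two_le (j : ℕ) : tau (j + 2) ≤ 2 * tau j + 3 := by
  induction j with
  | zero => decide
  | succ j ih =>
    have h : Nat.clog 2 (j + 4) ≤ 2 * Nat.clog 2 (j + 2) := by
      rw [Nat.clog_le_iff_le_pow (by norm_num), pow_mul']
      have := Nat.le_pow_clog (b := 2) (by norm_num) (j + 2)
      nlinarith
    have e1 := tau_succ (j + 2)
    have e2 := tau_succ j
    rw [show j + 1 + 2 = j + 2 + 1 by ring, e1, e2]
    rw [show j + 2 + 2 = j + 4 by ring]
    omega

theorem eta_pos (s : ℕ) : 1 ≤ eta s := by unfold eta; omega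

/-- Lets a tail bound that decays in the number of samples used be summed over the number of pulls.
-/
theorem le_two_mul_eta {s : ℕ} (hs : 1 ≤ s) : s ≤ 2 * eta s := by
  have h1 := one_le_iota hs
  have h2 := lt_tau_iota_succ s
  have h3 := tau_add_two_le (iota s - 1)
  rw [show iota s - 1 + 2 = iota s + 1 by omega] at h3
  unfold eta
  omega

theorem clog_two_succ_le_logb {N : ℕ} (hN : 1 ≤ N) :
    (Nat.clog 2 (N + 1) : ℝ) ≤ Real.logb 2 N + 1 := by
  have h1 : 1 ≤ Nat.clog 2 (N + 1) := Nat.clog_pos (by norm_num) (by omega)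
  have h2 : 2 ^ (Nat.clog 2 (N + 1) - 1) ≤ N := by
    have := Nat.pow_pred_clog_lt_self (b := 2) (by norm_num) (x := N + 1) (by omega)
    simp only [Nat.pred_eq_sub_one] at this
    omega
  have h3 : ((Nat.clog 2 (N + 1) - 1 : ℕ) : ℝ) ≤ Real.logb 2 N := by
    rw [Real.le_logb_iff_rpow_le (by norm_num) (by exact_mod_cast hN), Real.rpow_natCast]
    exact_mod_cast h2
  rw [Nat.cast_sub h1] at h3
  push_cast at h3
  linarith

/-- A pull count whose latest complete packet rests on at most `U` samples is itself
at most `U` up to logarithmic terms. -/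
theorem le_of_eta_le {s : ℕ} (hs : 1 ≤ s) {U : ℝ} (h : (eta s : ℝ) ≤ U) :
    (s : ℝ) ≤ U + 1 + 2 * Real.logb 2 ⌈U⌉ := by
  have h1 := one_le_iota hs
  obtain ⟨j, hj⟩ : ∃ j, iota s = j + 1 := ⟨_, (Nat.sub_add_cancel h1).symm⟩
  have h2 := lt_tau_iota_succ s
  -- The pulls beyond `tau j` span at most two packets: the last complete one and the one under way.
  -- Their lengths give the two logarithms.
  rw [hj, show j + 1 + 1 = j + 2 by ring, show j + 2 = (j + 1) + 1 by ring,
    tau_succ, tau_succ] at h2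
  have heta : eta s = 1 + tau j := by unfold eta; rw [hj]; simp
  rw [heta] at h
  have hU1 : (1 : ℝ) ≤ U := by
    have : (1 : ℝ) ≤ ((1 + tau j : ℕ) : ℝ) := by exact_mod_cast (by omega : 1 ≤ 1 + tau j)
    linarith
  obtain ⟨N, hN⟩ : ∃ N : ℕ, ⌈U⌉ = N := ⟨⌈U⌉.toNat, (Int.toNat_of_nonneg (by positivity)).symm⟩
  have hUN : U ≤ N := by
    have := Int.le_ceil U
    rw [hN] at this; exact_mod_cast this
  have hN1 : 1 ≤ N := by exact_mod_cast hU1.trans hUN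
  have hjN : j + 1 ≤ N := by
    have h3 := le_tau j
    have : ((1 + tau j : ℕ) : ℝ) ≤ N := h.trans hUN
    have : 1 + tau j ≤ N := by exact_mod_cast this
    omega
  have c1 : (Nat.clog 2 (j + 2) : ℝ) ≤ Real.logb 2 N + 1 := by
    refine le_trans ?_ (clog_two_succ_le_logb hN1)
    exact_mod_cast Nat.clog_mono_right 2 (by omega)
  have c2 : (Nat.clog 2 (j + 1 + 2) : ℝ) ≤ Real.logb 2 N + 2 := by
    have h4 : Nat.clog 2 (j + 1 + 2) ≤ Nat.clog 2 (2 * N + 1) := Nat.clog_mono_right 2 (by omega)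
    have h5 := clog_two_succ_le_logb (N := 2 * N) (by omega)
    have h6 : Real.logb 2 ((2 * N : ℕ) : ℝ) = 1 + Real.logb 2 N := by
      push_cast
      rw [Real.logb_mul (by norm_num) (by positivity), Real.logb_self_eq_one (by norm_num)]
    rw [h6] at h5
    have h7 : (Nat.clog 2 (j + 1 + 2) : ℝ) ≤ Nat.clog 2 (2 * N + 1) := by exact_mod_cast h4
    linarith
  have h8 : (s : ℝ) + 1 ≤ tau j + Nat.clog 2 (j + 2) + Nat.clog 2 (j + 1 + 2) := by
    exact_mod_cast h2
  push_cast at h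
  rw [hN]
  push_cast
  linarith

/-- `tau` grows at most quadratically. With `y = 1 / δ` this bounds the pulls at which the rounding
error may exceed `δ`. -/
theorem lt_of_iota_succ_lt {s : ℕ} {y : ℝ} (h : (iota s : ℝ) + 1 < y) :
    (s : ℝ) ≤ y * (y + 1) / 2 := by
  have h1 := lt_tau_iota_succ s
  have h2 := two_mul_tau_le (iota s + 1)
  have h3 : 2 * s ≤ (iota s + 1) * (iota s + 1 + 1) := by omega
  have h4 : 2 * (s : ℝ) ≤ (iota s + 1) * (iota s + 1 + 1) := by exact_mod_cast h3
  have h5 : (0 : ℝ) ≤ iota s := by positivity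
  nlinarith

/-! ### Decoding -/

theorem Gam_zero {x : ℝ} (h0 : 0 ≤ x) (h1 : x ≤ 1) : Gam 0 x = 0 := by
  unfold Gam
  split_ifs with h
  · rfl
  · have : ⌈(2 : ℝ) ^ 0 * x⌉ = 1 := by
      rw [Int.ceil_eq_iff]
      have : 0 < x := lt_of_le_of_ne h0 (Ne.symm h)
      constructor <;> norm_num <;> linarith
    rw [this]; rfl

/-- The weighted bits are successive differences of `2 ^ (-α) * Gam α x`, which starts at zero, so
the sum telescopes. -/
theorem sum_bits (x : ℝ) (h0 : 0 ≤ x) (h1 : x ≤ 1) (l : ℕ) :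
    ∑ α ∈ Finset.range l, ((2 : ℝ) ^ (α + 1))⁻¹ * ((Gam (α + 1) x - 2 * Gam α x : ℤ) : ℝ)
      = ((2 : ℝ) ^ l)⁻¹ * Gam l x := by
  induction l with
  | zero => simp [Gam_zero h0 h1]
  | succ l ih =>
    rw [Finset.sum_range_succ, ih]
    push_cast
    field_simp
    ring

/-- The extra grid step cancels the `-1` in `Gam`, leaving a ceiling on the grid of mesh `2 ^ (-l)`;
at `x = 0` the result is one grid step. -/
theorem quantization_bounds {x : ℝ} (h0 : 0 ≤ x) (h1 : x ≤ 1) (l : ℕ) :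
    x ≤ ((2 : ℝ) ^ l)⁻¹ * Gam l x + ((2 : ℝ) ^ l)⁻¹ ∧
    ((2 : ℝ) ^ l)⁻¹ * Gam l x + ((2 : ℝ) ^ l)⁻¹ ≤ x + ((2 : ℝ) ^ l)⁻¹ ∧
    ((2 : ℝ) ^ l)⁻¹ * Gam l x + ((2 : ℝ) ^ l)⁻¹ ≤ 1 := by
  have hp : (0 : ℝ) < 2 ^ l := by positivity
  have hp1 : (1 : ℝ) ≤ 2 ^ l := one_le_pow₀ (by norm_num)
  unfold Gam
  split_ifs with h
  · subst h
    have : ((2 : ℝ) ^ l)⁻¹ ≤ 1 := inv_le_one_of_one_le₀ hp1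
    simp
    exact this
  · have e : ((2 : ℝ) ^ l)⁻¹ * ((⌈(2 : ℝ) ^ l * x⌉ - 1 : ℤ) : ℝ) + ((2 : ℝ) ^ l)⁻¹
        = ⌈(2 : ℝ) ^ l * x⌉ / 2 ^ l := by
      push_cast; field_simp; ring
    rw [e]
    refine ⟨?_, ?_, ?_⟩
    · rw [le_div_iff₀ hp, mul_comm]; exact Int.le_ceil _
    · rw [div_le_iff₀ hp, add_mul, inv_mul_cancel₀ hp.ne', mul_comm x]
      exact (Int.ceil_lt_add_one _).le
    · rw [div_le_one hp]
      have : ⌈(2 : ℝ) ^ l * x⌉ ≤ 2 ^ l := by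
        rw [Int.ceil_le]; push_cast; nlinarith
      exact_mod_cast this

/-- The mean of the first `m` terms of a sequence. -/
noncomputable def prefixMean (x : ℕ → ℝ) (m : ℕ) : ℝ := (∑ i ∈ Finset.range m, x i) / m

theorem empMean_eq_prefixMean (x : ℕ → ℝ) {s m : ℕ} (h : m ≤ s) :
    empMean (fun j : Fin s => x j) m = prefixMean x m := by
  unfold empMean prefixMean
  congr 1
  rw [Finset.sum_filter, Fin.sum_univ_eq_sum_range (fun i => if i < m then x i else 0) s,
    ← Finset.sum_filter]
  congr 1
  ext i
  simp only [Finset.mem_filter, Finset.mem_range]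
  omega

theorem prefixMean_mem {x : ℕ → ℝ} (hx : ∀ i, x i ∈ Set.Icc (0 : ℝ) 1) (m : ℕ) :
    prefixMean x m ∈ Set.Icc (0 : ℝ) 1 := by
  unfold prefixMean
  constructor
  · exact div_nonneg (Finset.sum_nonneg fun i _ => (hx i).1) (by positivity)
  · apply div_le_one_of_le₀ _ (by positivity)
    calc ∑ i ∈ Finset.range m, x i ≤ ∑ i ∈ Finset.range m, 1 :=
          Finset.sum_le_sum fun i _ => (hx i).2
      _ = m := by simp

/-- The leader's decoded estimate is the dyadic rounding-up of the mean of the first `eta s`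
rewards. -/
theorem decode_packetPolicy {x : ℕ → ℝ} (hx : ∀ i, x i ∈ Set.Icc (0 : ℝ) 1) {s : ℕ} (hs : 1 ≤ s) :
    decode (fun i : Fin s => packetPolicy (i.val + 1) (fun j => x j.val))
      = ((2 : ℝ) ^ Nat.clog 2 (iota s + 1))⁻¹ *
          Gam (Nat.clog 2 (iota s + 1)) (prefixMean x (eta s))
        + ((2 : ℝ) ^ Nat.clog 2 (iota s + 1))⁻¹ := by
  have h1 := one_le_iota hs
  obtain ⟨j, hj⟩ : ∃ j, iota s = j + 1 := ⟨_, (Nat.sub_add_cancel h1).symm⟩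
  have htau : tau (j + 1) ≤ s := hj ▸ tau_iota_le s
  have hsucc := tau_succ j
  have heta : eta s = 1 + tau j := by unfold eta; rw [hj]; simp
  unfold decode
  rw [hj]
  simp only [Nat.add_sub_cancel]
  rw [← sum_bits _ (prefixMean_mem hx _).1 (prefixMean_mem hx _).2, heta,
    show j + 1 + 1 = j + 2 by ring]
  congr 1
  · rw [Finset.sum_filter]
    have := Fin.sum_univ_eq_sum_range (fun i => if tau j < i + 1 ∧ i + 1 ≤ tau (j + 1) then
      (2 : ℝ) ^ ((tau j : ℤ) - (i + 1 : ℤ)) *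
        ((packetPolicy (i + 1) (fun l => x l.val)).toNat : ℝ) else 0) s
    rw [this, ← Finset.sum_filter]
    have hset : (Finset.range s).filter (fun i => tau j < i + 1 ∧ i + 1 ≤ tau (j + 1))
        = Finset.Ico (tau j) (tau (j + 1)) := by
      ext i
      simp only [Finset.mem_filter, Finset.mem_range, Finset.mem_Ico]
      omega
    rw [hset, Finset.sum_Ico_eq_sum_range, hsucc, Nat.add_sub_cancel_left]
    refine Finset.sum_congr rfl fun α hα => ?_
    rw [Finset.mem_range] at hα
    -- Bit number `tau j + α + 1` evaluates `iota` one step earlier, so all bits of a packet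
    -- quantize the same mean.
    have hi : iota (tau j + α) = j := iota_eq_of_mem (by omega) (by omega)
    congr 1
    · rw [← zpow_natCast, ← zpow_neg]
      congr 1
      push_cast
      ring
    · unfold packetPolicy
      simp only [Nat.add_sub_cancel, hi]
      rw [empMean_eq_prefixMean x (by omega), show tau j + α + 1 - tau j = α + 1 by omega,
        Nat.add_sub_cancel]
      rcases Gam_bit α (prefixMean x (1 + tau j)) with h | h <;> simp [h]
  · rw [hsucc, ← zpow_natCast, ← zpow_neg]
    congr 1
    push_cast
    ring

theorem decode_bounds {x : ℕ → ℝ} (hx : ∀ i, x i ∈ Set.Icc (0 : ℝ) 1) {s : ℕ} (hs : 1 ≤ s) :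
    prefixMean x (eta s)
        ≤ decode (fun i : Fin s => packetPolicy (i.val + 1) (fun j => x j.val)) ∧
      decode (fun i : Fin s => packetPolicy (i.val + 1) (fun j => x j.val))
        ≤ prefixMean x (eta s) + 1 / (iota s + 1) ∧
      decode (fun i : Fin s => packetPolicy (i.val + 1) (fun j => x j.val)) ≤ 1 := by
  rw [decode_packetPolicy hx hs]
  obtain ⟨h1, h2, h3⟩ := quantization_bounds (prefixMean_mem hx (eta s)).1
    (prefixMean_mem hx (eta s)).2 (Nat.clog 2 (iota s + 1))
  refine ⟨h1, h2.trans ?_, h3⟩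
  gcongr
  rw [← one_div]
  apply one_div_le_one_div_of_le (by positivity)
  exact_mod_cast Nat.le_pow_clog (b := 2) (by norm_num) (iota s + 1)

/-! ### The Bernoulli divergence -/

/-- The Bernoulli Kullback-Leibler divergence as a real number, for `0 < q < 1`. -/
noncomputable def kl (p q : ℝ) : ℝ :=
  p * Real.log (p / q) + (1 - p) * Real.log ((1 - p) / (1 - q))

theorem d_eq_kl (p : ℝ) {q : ℝ} (h0 : 0 < q) (h1 : q < 1) : d p q = (kl p q : ℝ) := by
  have hk : ∀ p q : ℝ, q ≠ 0 → klTerm p q = ((p * Real.log (p / q) : ℝ) : EReal) := by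
    intro p q hq
    unfold klTerm
    split_ifs with h
    · simp [h]
    · rfl
  rw [d, hk _ _ h0.ne', hk _ _ (by linarith : (1 : ℝ) - q ≠ 0), kl, EReal.coe_add]

theorem d_one_eq_top {p : ℝ} (h1 : p < 1) : d p 1 = ⊤ := by
  have : klTerm p 1 ≠ ⊥ := by
    unfold klTerm
    split_ifs
    · simp
    · simp
    · exact EReal.coe_ne_bot _
  have h2 : klTerm (1 - p) (1 - 1) = ⊤ := by
    unfold klTerm
    rw [if_neg (by linarith), if_pos (by norm_num)]
  rw [d, h2, EReal.add_top_of_ne_bot this]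

theorem mul_log_div (p : ℝ) {q : ℝ} (h : q ≠ 0) :
    p * Real.log (p / q) = p * Real.log p - p * Real.log q := by
  by_cases hp : p = 0
  · simp [hp]
  · rw [Real.log_div hp h]; ring

theorem kl_eq (p : ℝ) {q : ℝ} (h0 : 0 < q) (h1 : q < 1) :
    kl p q = (p * Real.log p + (1 - p) * Real.log (1 - p))
      - p * Real.log q - (1 - p) * Real.log (1 - q) := by
  rw [kl, mul_log_div p h0.ne', mul_log_div (1 - p) (by linarith : (1 : ℝ) - q ≠ 0)]
  ring

theorem kl_self (q : ℝ) : kl q q = 0 := by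
  unfold kl
  by_cases h : q = 0
  · simp [h]
  · by_cases h' : 1 - q = 0
    · simp [h', h]
    · simp [div_self h, div_self h']

theorem continuous_kl_left {q : ℝ} (h0 : 0 < q) (h1 : q < 1) : Continuous fun p => kl p q := by
  simp_rw [kl_eq _ h0 h1]
  have h2 : Continuous fun p : ℝ => p * Real.log p := Real.continuous_mul_log
  have h3 : Continuous fun p : ℝ => (1 - p) * Real.log (1 - p) :=
    Real.continuous_mul_log.comp (continuous_const.sub continuous_id)
  fun_prop

theorem continuousAt_kl_right (p : ℝ) {q : ℝ} (h0 : 0 < q) (h1 : q < 1) :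
    ContinuousAt (fun q => kl p q) q := by
  have : (fun q => kl p q) =ᶠ[𝓝 q] fun q => (p * Real.log p + (1 - p) * Real.log (1 - p))
      - p * Real.log q - (1 - p) * Real.log (1 - q) := by
    filter_upwards [Ioo_mem_nhds h0 h1] with y hy using kl_eq p hy.1 hy.2
  rw [continuousAt_congr this]
  have h2 : (1 : ℝ) - q ≠ 0 := by linarith
  have h3 : ContinuousAt (fun q : ℝ => Real.log (1 - q)) q :=
    (continuousAt_const.sub continuousAt_id).log h2
  have h4 : ContinuousAt (fun q : ℝ => Real.log q) q := Real.continuousAt_log h0.ne'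
  fun_prop

/-- **Gibbs' inequality** for Bernoulli distributions. -/
theorem kl_nonneg {p q : ℝ} (hp0 : 0 ≤ p) (hp1 : p ≤ 1) (h0 : 0 < q) (h1 : q < 1) :
    0 ≤ kl p q := by
  have key : ∀ p q : ℝ, 0 ≤ p → 0 < q → p - q ≤ p * Real.log (p / q) := by
    intro p q hp hq
    rcases hp.eq_or_lt with rfl | hp
    · simp [hq.le]
    · have := Real.log_le_sub_one_of_pos (div_pos hq hp)
      rw [← inv_div, Real.log_inv] at this
      have h2 : p * (-Real.log (p / q)) ≤ p * ((p / q)⁻¹ - 1) :=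
        mul_le_mul_of_nonneg_left this hp.le
      have h3 : p * ((p / q)⁻¹ - 1) = q - p := by field_simp
      linarith
  have h2 := key p q hp0 h0
  have h3 := key (1 - p) (1 - q) (by linarith) (by linarith)
  unfold kl
  linarith

/-- **Pinsker's inequality** for Bernoulli distributions. -/
theorem two_mul_sq_le_kl {p q : ℝ} (hp0 : 0 ≤ p) (hpq : p ≤ q) (h0 : 0 < q) (h1 : q < 1) :
    2 * (q - p) ^ 2 ≤ kl p q := by
  rcases hpq.eq_or_lt with rfl | hlt
  · rw [kl_self]; simp
  -- Up to a constant in `y` this is `kl p y - 2 * (y - p) ^ 2`; its derivative is `(y - p) * (1 - 2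
  -- * y) ^ 2 / (y * (1 - y))`.
  let h : ℝ → ℝ := fun y => - p * Real.log y - (1 - p) * Real.log (1 - y) - 2 * (y - p) ^ 2
  have hmono : MonotoneOn h (Set.Icc p q) := by
    apply monotoneOn_of_deriv_nonneg (convex_Icc p q)
    · have c1 : ContinuousOn (fun y => - p * Real.log y) (Set.Icc p q) := by
        -- For `p = 0` the interval contains the singularity of the logarithm, but its coefficient
        -- vanishes.
        rcases hp0.eq_or_lt with rfl | hp
        · simpa using continuousOn_const
        · exact continuousOn_const.mul (Real.continuousOn_log.mono fun y hy => by
            simpa using (hp.trans_le hy.1).ne')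
      have c2 : ContinuousOn (fun y : ℝ => Real.log (1 - y)) (Set.Icc p q) :=
        (continuousOn_const.sub continuousOn_id).log fun y hy => by
          have := hy.2
          intro h
          change (1 : ℝ) - y = 0 at h
          linarith
      have c3 : ContinuousOn (fun y => 2 * (y - p) ^ 2) (Set.Icc p q) := by fun_prop
      exact (c1.sub (continuousOn_const.mul c2)).sub c3
    all_goals
      rw [interior_Icc]
    · intro y hy
      have : y ≠ 0 := (hp0.trans_lt hy.1).ne'
      have : 1 - y ≠ 0 := by have := hy.2; intro h; linarith
      apply DifferentiableAt.differentiableWithinAt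
      simp only [h]
      fun_prop (disch := assumption)
    · intro y hy
      have y0 : 0 < y := hp0.trans_lt hy.1
      have y1 : 0 < 1 - y := by have := hy.2; linarith
      have hd : HasDerivAt h (- p * y⁻¹ - (1 - p) * (-1 / (1 - y)) - 2 * (2 * (y - p))) y := by
        have d1 := (Real.hasDerivAt_log y0.ne').const_mul (-p)
        have d2 := (((hasDerivAt_id y).const_sub 1).log y1.ne').const_mul (1 - p)
        have d3 := (((hasDerivAt_id y).sub_const p).pow 2).const_mul 2
        have d4 := (d1.sub d2).sub d3
        simp only [id, Nat.cast_ofNat, Nat.add_one_sub_one, pow_one, mul_one] at d4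
        exact d4
      rw [hd.deriv]
      have e : - p * y⁻¹ - (1 - p) * (-1 / (1 - y)) - 2 * (2 * (y - p))
          = (y - p) * (1 - 2 * y) ^ 2 / (y * (1 - y)) := by
        field_simp
        ring
      rw [e]
      have : 0 ≤ y - p := by linarith [hy.1]
      positivity
  have := hmono (Set.left_mem_Icc.2 hpq) (Set.right_mem_Icc.2 hpq) hpq
  rw [kl_eq p h0 h1]
  simp only [h] at this
  nlinarith

/-- The defect is exactly `(r - p)` times the log-odds of `q` minus those of `r`. Monotonicity in
each argument and the margin gained in the Chernoff bound both come from here. -/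
theorem kl_three_point {p r q : ℝ} (hpr : p ≤ r) (hr : 0 < r) (hrq : r ≤ q)
    (hq : q < 1) : kl p r + kl r q ≤ kl p q := by
  have hq0 : 0 < q := hr.trans_le hrq
  rw [kl_eq p hr (hrq.trans_lt hq), kl_eq r hq0 hq, kl_eq p hq0 hq]
  have h1 : Real.log r ≤ Real.log q := Real.log_le_log hr hrq
  have h2 : Real.log (1 - q) ≤ Real.log (1 - r) := Real.log_le_log (by linarith) (by linarith)
  nlinarith [mul_nonneg (sub_nonneg.2 hpr) (sub_nonneg.2 h1),
    mul_nonneg (sub_nonneg.2 hpr) (sub_nonneg.2 h2)]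

theorem kl_antitone_left {p r q : ℝ} (hp : 0 ≤ p) (hpr : p ≤ r) (hrq : r ≤ q)
    (hq : q < 1) : kl r q ≤ kl p q := by
  rcases (hp.trans hpr).eq_or_lt with h | hr
  · rw [show p = r by linarith]
  · have := kl_three_point hpr hr hrq hq
    have := kl_nonneg hp (by linarith : p ≤ 1) hr (by linarith)
    linarith

theorem kl_monotone_right {p r q : ℝ} (hpr : p ≤ r) (hr : 0 < r) (hrq : r ≤ q)
    (hq : q < 1) : kl p r ≤ kl p q := by
  have := kl_three_point hpr hr hrq hq
  have := kl_nonneg hr.le (by linarith : r ≤ 1) (hr.trans_le hrq) hq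
  linarith

/-- The arguments are moved one at a time; `log x ≤ x - 1` makes each move cost at most half of the
bound. -/
theorem kl_sub_kl_le {a b e : ℝ} (ha : 0 < a) (hb : b < 1) (he : 0 ≤ e) (hab : a + e ≤ b - e) :
    kl a b - kl (a + e) (b - e) ≤ 2 * e * (b - a) * (1 / a + 1 / (1 - b)) := by
  have hb0 : 0 < b := by linarith
  have hb'0 : 0 < b - e := by linarith
  have hb'1 : 0 < 1 - (b - e) := by linarith
  have hb1 : 0 < 1 - b := by linarith
  have ha1 : 0 < 1 - a := by linarith
  have hB : 0 ≤ e * (b - a) * (1 / a + 1 / (1 - b)) := by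
    have : 0 ≤ b - a := by linarith
    positivity
  have s1 : kl a b - kl a (b - e) ≤ e * (b - a) * (1 / a + 1 / (1 - b)) := by
    have i1 : Real.log (b - e) - Real.log b ≤ (b - e) / b - 1 := by
      rw [← Real.log_div hb'0.ne' hb0.ne']
      exact Real.log_le_sub_one_of_pos (by positivity)
    have i2 : Real.log (1 - (b - e)) - Real.log (1 - b) ≤ (1 - (b - e)) / (1 - b) - 1 := by
      rw [← Real.log_div hb'1.ne' hb1.ne']
      exact Real.log_le_sub_one_of_pos (by positivity)
    have e1 : a * ((b - e) / b - 1) + (1 - a) * ((1 - (b - e)) / (1 - b) - 1)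
        = e * (b - a) * (1 / b + 1 / (1 - b)) := by field_simp; ring
    have e2 : e * (b - a) * (1 / b + 1 / (1 - b)) ≤ e * (b - a) * (1 / a + 1 / (1 - b)) := by
      have : 0 ≤ b - a := by linarith
      have : 1 / b ≤ 1 / a := one_div_le_one_div_of_le ha (by linarith)
      gcongr
    rw [kl_eq a hb0 hb, kl_eq a hb'0 (by linarith)]
    have j1 := mul_le_mul_of_nonneg_left i1 ha.le
    have j2 := mul_le_mul_of_nonneg_left i2 ha1.le
    linarith
  have s2 : kl a (b - e) - kl (a + e) (b - e) ≤ e * (b - a) * (1 / a + 1 / (1 - b)) := by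
    -- Gibbs' inequality acts as the tangent inequality at `a` for the convex function `p log p + (1
    -- - p) log (1 - p)`.
    have g := kl_nonneg (p := a + e) (q := a) (by linarith) (by linarith) ha (by linarith)
    have i1 : Real.log (b - e) - Real.log a ≤ (b - e) / a - 1 := by
      rw [← Real.log_div hb'0.ne' ha.ne']
      exact Real.log_le_sub_one_of_pos (by positivity)
    have i2 : Real.log (1 - a) - Real.log (1 - (b - e)) ≤ (1 - a) / (1 - (b - e)) - 1 := by
      rw [← Real.log_div ha1.ne' hb'1.ne']
      exact Real.log_le_sub_one_of_pos (by positivity)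
    have e1 : ((b - e) / a - 1) + ((1 - a) / (1 - (b - e)) - 1)
        = (b - e - a) * (1 / a + 1 / (1 - (b - e))) := by field_simp; ring
    have e2 : (b - e - a) * (1 / a + 1 / (1 - (b - e))) ≤ (b - a) * (1 / a + 1 / (1 - b)) := by
      have : 1 / (1 - (b - e)) ≤ 1 / (1 - b) := one_div_le_one_div_of_le hb1 (by linarith)
      have : 0 ≤ 1 / a + 1 / (1 - (b - e)) := by positivity
      apply mul_le_mul <;> linarith
    have j := mul_le_mul_of_nonneg_left (show (Real.log (b - e) - Real.log a)
      + (Real.log (1 - a) - Real.log (1 - (b - e))) ≤ (b - a) * (1 / a + 1 / (1 - b)) by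
        linarith) he
    rw [kl_eq (a + e) ha (by linarith)] at g
    rw [kl_eq a hb'0 (by linarith), kl_eq (a + e) hb'0 (by linarith)]
    linarith
  linarith

/-! ### The KL-UCB index -/

theorem f_pos (t : ℕ) : 0 < f t := by unfold f; positivity

theorem log_f_nonneg (t : ℕ) : 0 ≤ Real.log (f t) := by
  apply Real.log_nonneg
  unfold f
  have : 0 ≤ (t : ℝ) * Real.log t ^ 2 := by positivity
  linarith

theorem f_mono {s t : ℕ} (hs : 1 ≤ s) (h : s ≤ t) : f s ≤ f t := by
  unfold f
  have h1 : (1 : ℝ) ≤ s := by exact_mod_cast hs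
  have h2 : (s : ℝ) ≤ t := by exact_mod_cast h
  have h3 : 0 ≤ Real.log s := Real.log_nonneg h1
  gcongr

theorem bddAbove_gKL (t : ℕ) (x : ℝ) (s : ℕ) :
    BddAbove {y : ℝ | y ∈ Set.Icc (0 : ℝ) 1 ∧ d x y ≤ ((Real.log (f t) / s : ℝ) : EReal)} :=
  ⟨1, fun _ hy => hy.1.2⟩

theorem of_gKL_lt {t s : ℕ} {x y : ℝ} (hx0 : 0 ≤ x) (hx1 : x ≤ 1) (hy0 : 0 < y) (hy1 : y < 1)
    (h : gKL t x s < y) : x < y ∧ Real.log (f t) / s < kl x y := by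
  have hnn : 0 ≤ Real.log (f t) / s := div_nonneg (log_f_nonneg t) (by positivity)
  constructor
  · by_contra hxy
    refine absurd (le_csSup (bddAbove_gKL t x s) ?_) (not_le.2 (h.trans_le (not_lt.1 hxy)))
    refine ⟨⟨hx0, hx1⟩, ?_⟩
    rcases hx0.eq_or_lt with rfl | hx0
    · simpa [d, klTerm] using hnn
    rcases hx1.eq_or_lt with rfl | hx1
    · simpa [d, klTerm] using hnn
    · rw [d_eq_kl x hx0 hx1, kl_self]
      exact_mod_cast hnn
  · by_contra hd
    refine absurd (le_csSup (bddAbove_gKL t x s) ?_) (not_le.2 h)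
    refine ⟨⟨hy0.le, hy1.le⟩, ?_⟩
    rw [d_eq_kl x hy0 hy1]
    exact_mod_cast not_lt.1 hd

/-- The supremum need not be known to be attained: each `z` in `(x, y)` lies below an admissible
point, and continuity at `y` finishes. -/
theorem kl_le_of_le_gKL {t s : ℕ} {x y : ℝ} (hx0 : 0 ≤ x) (hxy : x < y) (hy1 : y < 1)
    (h : y ≤ gKL t x s) : kl x y ≤ Real.log (f t) / s := by
  have hy0 : 0 < y := hx0.trans_lt hxy
  have key : ∀ z ∈ Set.Ioo x y, kl x z ≤ Real.log (f t) / s := by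
    intro z hz
    have hne : {y : ℝ | y ∈ Set.Icc (0 : ℝ) 1 ∧
        d x y ≤ ((Real.log (f t) / s : ℝ) : EReal)}.Nonempty := by
      -- The supremum of the empty set is `0` by default, which `0 < y` excludes.
      by_contra hemp
      rw [Set.not_nonempty_iff_eq_empty] at hemp
      unfold gKL at h
      rw [hemp, Real.sSup_empty] at h
      linarith
    obtain ⟨v, ⟨⟨hv0, hv1⟩, hv⟩, hzv⟩ := exists_lt_of_lt_csSup hne (hz.2.trans_le h)
    rcases hv1.eq_or_lt with rfl | hv1
    · rw [d_one_eq_top (hxy.trans hy1)] at hv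
      exact absurd hv (not_le.2 (EReal.coe_lt_top _))
    · rw [d_eq_kl x (hx0.trans_lt (hz.1.trans hzv)) hv1] at hv
      exact (kl_monotone_right hz.1.le (hx0.trans_lt hz.1) hzv.le hv1).trans
        (by exact_mod_cast hv)
  have hlim : Tendsto (fun z => kl x z) (𝓝[<] y) (𝓝 (kl x y)) :=
    (continuousAt_kl_right x hy0 hy1).tendsto.mono_left nhdsWithin_le_nhds
  exact le_of_tendsto hlim (by filter_upwards [Ioo_mem_nhdsLT hxy] with z hz using key z hz)

/-! ### Tail bounds for empirical means -/

section Concentration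

variable {Ω : Type*} [MeasurableSpace Ω] {P : Measure Ω} [IsProbabilityMeasure P]

/-- Convexity puts `exp (t * Y)` below the chord `1 - Y + Y * exp t`, so the Bernoulli law is
extremal for a given mean. -/
theorem mgf_le_of_mem_unitInterval {Y : Ω → ℝ} (hm : Measurable Y)
    (hb : ∀ᵐ ω ∂P, Y ω ∈ Set.Icc (0 : ℝ) 1) (t : ℝ) :
    mgf Y P t ≤ 1 - (∫ ω, Y ω ∂P) + (∫ ω, Y ω ∂P) * Real.exp t := by
  have hint : Integrable Y P := Integrable.of_mem_Icc 0 1 hm.aemeasurable hb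
  have h1 : mgf Y P t ≤ ∫ ω, (1 + Y ω * (Real.exp t - 1)) ∂P := by
    apply integral_mono_ae (integrable_exp_mul_of_mem_Icc hm.aemeasurable hb)
      ((integrable_const _).add (hint.mul_const _))
    filter_upwards [hb] with ω hω
    have := convexOn_exp.2 (Set.mem_univ 0) (Set.mem_univ t) (sub_nonneg.2 hω.2) hω.1 (by ring)
    simp only [smul_eq_mul, mul_zero, zero_add, Real.exp_zero, mul_one] at this
    rw [mul_comm t]
    change _ ≤ 1 + Y ω * (Real.exp t - 1)
    linarith
  rw [integral_add (integrable_const _) (hint.mul_const _), integral_mul_const] at h1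
  simp only [integral_const, probReal_univ, smul_eq_mul, mul_one] at h1
  linarith

/-- **Chernoff's bound** for the lower tail of a mean of independent variables in `[0,1]`. -/
theorem prob_prefixMean_le {Y : ℕ → Ω → ℝ} {m : ℝ} (hm : ∀ i, Measurable (Y i))
    (hb : ∀ i, ∀ᵐ ω ∂P, Y i ω ∈ Set.Icc (0 : ℝ) 1) (hind : iIndepFun Y P)
    (hmean : ∀ i, ∫ ω, Y i ω ∂P = m) {x : ℝ} (hx : 0 < x) (hxm : x ≤ m) (hm1 : m < 1)
    {s : ℕ} (hs : 1 ≤ s) :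
    P.real {ω | prefixMean (fun i => Y i ω) s ≤ x} ≤ Real.exp (-s * kl x m) := by
  have hm0 : 0 < m := hx.trans_le hxm
  have h1m : 0 < 1 - m := by linarith
  have h1x : 0 < 1 - x := by linarith
  have hs0 : (0 : ℝ) < s := by exact_mod_cast hs
  -- `log r` is the optimal tilt; the Bernoulli moment generating function there is `(1 - m) / (1 -
  -- x)`.
  set r : ℝ := x * (1 - m) / (m * (1 - x)) with hr
  have hr0 : 0 < r := by positivity
  have hr1 : r ≤ 1 := by
    rw [hr, div_le_one (by positivity)]; nlinarith
  have ht : Real.log r ≤ 0 := Real.log_nonpos hr0.le hr1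
  have hsum : ∀ᵐ ω ∂P, (∑ i ∈ Finset.range s, Y i) ω ∈ Set.Icc (0 : ℝ) s := by
    filter_upwards [ae_all_iff.2 hb] with ω hω
    rw [Finset.sum_apply]
    refine ⟨Finset.sum_nonneg fun i _ => (hω i).1, ?_⟩
    calc ∑ i ∈ Finset.range s, Y i ω ≤ ∑ i ∈ Finset.range s, 1 :=
          Finset.sum_le_sum fun i _ => (hω i).2
      _ = s := by simp
  have hmeas : AEMeasurable (∑ i ∈ Finset.range s, Y i) P :=
    (by fun_prop : Measurable (∑ i ∈ Finset.range s, Y i)).aemeasurable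
  have h := measure_le_le_exp_mul_mgf (μ := P) (X := ∑ i ∈ Finset.range s, Y i) (s * x) ht
    (integrable_exp_mul_of_mem_Icc hmeas hsum)
  have hset : {ω | prefixMean (fun i => Y i ω) s ≤ x}
      = {ω | (∑ i ∈ Finset.range s, Y i) ω ≤ s * x} := by
    ext ω
    simp only [Set.mem_ofPred_eq, Finset.sum_apply, prefixMean]
    rw [div_le_iff₀ hs0, mul_comm]
  rw [hset]
  refine h.trans ?_
  have hmgf : mgf (∑ i ∈ Finset.range s, Y i) P (Real.log r) ≤ ((1 - m) / (1 - x)) ^ s := by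
    rw [hind.mgf_sum hm]
    calc ∏ i ∈ Finset.range s, mgf (Y i) P (Real.log r)
        ≤ ∏ _i ∈ Finset.range s, ((1 - m) / (1 - x)) := by
          apply Finset.prod_le_prod (fun i _ => mgf_nonneg)
          intro i _
          refine (mgf_le_of_mem_unitInterval (hm i) (hb i) _).trans (le_of_eq ?_)
          rw [hmean i, Real.exp_log hr0, hr]
          field_simp
          ring
      _ = _ := by rw [Finset.prod_const, Finset.card_range]
  refine (mul_le_mul_of_nonneg_left hmgf (Real.exp_pos _).le).trans (le_of_eq ?_)
  have h2 : ((1 - m) / (1 - x)) ^ s = Real.exp (s * (Real.log (1 - m) - Real.log (1 - x))) := by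
    rw [← Real.log_div h1m.ne' h1x.ne', Real.exp_nat_mul, Real.exp_log (by positivity)]
  rw [h2, ← Real.exp_add, kl_eq x hm0 hm1, hr, Real.log_div (by positivity) (by positivity),
    Real.log_mul hx.ne' h1m.ne', Real.log_mul hm0.ne' h1x.ne']
  congr 1
  ring

/-- The index of the best arm is unlikely to fall below `y < m`. -/
theorem prob_lt_kl_prefixMean {Y : ℕ → Ω → ℝ} {m : ℝ} (hm : ∀ i, Measurable (Y i))
    (hb : ∀ i, ∀ᵐ ω ∂P, Y i ω ∈ Set.Icc (0 : ℝ) 1) (hind : iIndepFun Y P)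
    (hmean : ∀ i, ∫ ω, Y i ω ∂P = m) {y : ℝ} (hy : 0 < y) (hym : y < m) (hm1 : m < 1)
    {s : ℕ} (hs : 1 ≤ s) (L : ℝ) :
    P.real {ω | prefixMean (fun i => Y i ω) s < y ∧ L < kl (prefixMean (fun i => Y i ω) s) y}
      ≤ Real.exp (-s * (L + 2 * (m - y) ^ 2)) := by
  have hy1 : y < 1 := hym.trans hm1
  -- The event lies in a lower tail with threshold `sSup S`, at which continuity still gives
  -- divergence at least `L` from `y`.
  set S : Set ℝ := {x | 0 ≤ x ∧ x < y ∧ L < kl x y} with hS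
  have hae : ∀ᵐ ω ∂P, 0 ≤ prefixMean (fun i => Y i ω) s := by
    filter_upwards [ae_all_iff.2 hb] with ω hω using (prefixMean_mem hω s).1
  have hcont := continuous_kl_left hy hy1
  by_cases hne : S.Nonempty
  · have hbdd : BddAbove S := ⟨y, fun x hx => hx.2.1.le⟩
    have hcy : sSup S ≤ y := csSup_le hne fun x hx => hx.2.1.le
    have hkl : L ≤ kl (sSup S) y := by
      have hcl : IsClosed {x : ℝ | L ≤ kl x y} := isClosed_le continuous_const hcont
      have hsub : S ⊆ {x : ℝ | L ≤ kl x y} := fun x hx => hx.2.2.le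
      exact hcl.closure_subset_iff.2 hsub (csSup_mem_closure hne hbdd)
    -- The Chernoff bound needs a positive threshold. Even if `0` is the point found in `S`,
    -- continuity puts small positive points there too.
    have hc0 : 0 < sSup S := by
      obtain ⟨x, hx⟩ := hne
      rcases hx.1.eq_or_lt with h0 | h0
      · subst h0
        have hev : ∀ᶠ z in 𝓝[>] (0 : ℝ), z < y ∧ L < kl z y := by
          apply Filter.Eventually.filter_mono nhdsWithin_le_nhds
          exact (eventually_lt_nhds hy).and ((isOpen_lt continuous_const hcont).mem_nhds hx.2.2)
        obtain ⟨z, hz, hz0⟩ := (hev.and self_mem_nhdsWithin).exists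
        exact lt_of_lt_of_le hz0 (le_csSup hbdd ⟨le_of_lt hz0, hz⟩)
      · exact h0.trans_le (le_csSup hbdd hx)
    calc _ ≤ P.real {ω | prefixMean (fun i => Y i ω) s ≤ sSup S} := by
          apply ENNReal.toReal_mono (measure_ne_top _ _)
          apply measure_mono_ae
          filter_upwards [hae] with ω hω h
          exact le_csSup hbdd ⟨hω, h.1, h.2⟩
      _ ≤ Real.exp (-s * kl (sSup S) m) :=
          prob_prefixMean_le hm hb hind hmean hc0 (hcy.trans hym.le) hm1 hs
      _ ≤ _ := by
          apply Real.exp_le_exp.2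
          -- Splitting at `y` gives `L` on one side, and Pinsker turns the other into the margin `2
          -- * (m - y) ^ 2`.
          have h1 := kl_three_point hcy hy hym.le hm1
          have h2 := two_mul_sq_le_kl hy.le hym.le (hy.trans hym) hm1
          have hs0 : (0 : ℝ) ≤ s := by positivity
          nlinarith
  · have : P.real {ω | prefixMean (fun i => Y i ω) s < y ∧
        L < kl (prefixMean (fun i => Y i ω) s) y} = 0 := by
      rw [measureReal_eq_zero_iff]
      apply measure_mono_null _ hae
      intro ω hω h0
      exact hne ⟨_, h0, hω.1, hω.2⟩
    rw [this]
    exact (Real.exp_pos _).le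

/-- **Hoeffding's inequality** for the upper tail of a mean of independent variables in
`[0,1]`. -/
theorem prob_le_prefixMean {Y : ℕ → Ω → ℝ} {m : ℝ} (hm : ∀ i, Measurable (Y i))
    (hb : ∀ i, ∀ᵐ ω ∂P, Y i ω ∈ Set.Icc (0 : ℝ) 1) (hind : iIndepFun Y P)
    (hmean : ∀ i, ∫ ω, Y i ω ∂P = m) {δ : ℝ} (hδ : 0 ≤ δ) {s : ℕ} (hs : 1 ≤ s) :
    P.real {ω | m + δ ≤ prefixMean (fun i => Y i ω) s} ≤ Real.exp (-2 * s * δ ^ 2) := by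
  have hs0 : (0 : ℝ) < s := by exact_mod_cast hs
  have hind' : iIndepFun (fun i ω => Y i ω - m) P :=
    hind.comp (fun _ x => x - m) fun _ => measurable_id.sub_const m
  have h := HasSubgaussianMGF.measure_sum_range_ge_le_of_iIndepFun hind' (n := s)
    (c := (‖(1 : ℝ) - 0‖₊ / 2) ^ 2) (fun i _ => by
      have := hasSubgaussianMGF_of_mem_Icc (hm i).aemeasurable (hb i)
      rwa [hmean i] at this) (ε := s * δ) (by positivity)
  have hset : {ω | m + δ ≤ prefixMean (fun i => Y i ω) s}
      = {ω | s * δ ≤ ∑ i ∈ Finset.range s, (Y i ω - m)} := by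
    ext ω
    simp only [Set.mem_ofPred_eq, prefixMean]
    rw [le_div_iff₀ hs0, Finset.sum_sub_distrib]
    simp only [Finset.sum_const, Finset.card_range, nsmul_eq_mul]
    constructor <;> intro h <;> linarith
  rw [hset]
  refine h.trans (le_of_eq ?_)
  congr 1
  simp
  field_simp

end Concentration

/-! ### Series and counting bounds -/

theorem sum_exp_neg_le {a : ℝ} (ha : 0 < a) (n : ℕ) :
    ∑ s ∈ Finset.Icc 1 n, Real.exp (-a * s) ≤ 1 / a := by
  suffices h : a * ∑ s ∈ Finset.Icc 1 n, Real.exp (-a * s) ≤ 1 - Real.exp (-a * n) by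
    rw [le_div_iff₀ ha, mul_comm]
    linarith [Real.exp_pos (-a * n)]
  induction n with
  | zero => simp
  | succ n ih =>
    rw [Finset.sum_Icc_succ_top (by omega), mul_add]
    have e : Real.exp (-a * n) = Real.exp a * Real.exp (-a * (n + 1 : ℕ)) := by
      rw [← Real.exp_add]; congr 1; push_cast; ring
    have h1 := Real.add_one_le_exp a
    have h2 := Real.exp_pos (-a * (n + 1 : ℕ))
    nlinarith

/-- Each term is at most `1 / (t * log t ^ 2)`, hence at most an increment of `-1 / log`. The sum
starts after `2`, so it telescopes to at most `1 / log 2 ≤ 3 / 2`. -/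
theorem sum_inv_f_le {K n : ℕ} (hK : 2 ≤ K) :
    ∑ t ∈ Finset.Ioc K n, 1 / f t ≤ 3 / 2 := by
  have hlog2 : 0 < Real.log 2 := Real.log_pos (by norm_num)
  have key : ∀ n, 2 ≤ n → ∑ t ∈ Finset.Ioc 2 n, 1 / f t ≤ 1 / Real.log 2 - 1 / Real.log n := by
    intro n hn
    induction n, hn using Nat.le_induction with
    | base => simp
    | succ n hn ih =>
      rw [← Finset.insert_Ioc_right_eq_Ioc_add_one (by omega), Finset.sum_insert (by simp)]
      have hn0 : (2 : ℝ) ≤ n := by exact_mod_cast hn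
      have hl : 0 < Real.log n := Real.log_pos (by linarith)
      have hl' : 0 < Real.log ((n + 1 : ℕ) : ℝ) :=
        Real.log_pos (by push_cast; linarith)
      have hd : 1 / ((n + 1 : ℕ) : ℝ) ≤ Real.log ((n + 1 : ℕ) : ℝ) - Real.log n := by
        have := Real.log_le_sub_one_of_pos (show (0 : ℝ) < n / (n + 1 : ℕ) by positivity)
        rw [Real.log_div (by positivity) (by positivity)] at this
        have e : (n : ℝ) / ((n + 1 : ℕ) : ℝ) - 1 = - (1 / ((n + 1 : ℕ) : ℝ)) := by
          push_cast; field_simp; ring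
        linarith
      have h1 : 1 / f (n + 1) ≤ 1 / (((n + 1 : ℕ) : ℝ) * Real.log ((n + 1 : ℕ) : ℝ) ^ 2) := by
        apply one_div_le_one_div_of_le (by positivity)
        unfold f
        linarith
      have h2 : 1 / (((n + 1 : ℕ) : ℝ) * Real.log ((n + 1 : ℕ) : ℝ) ^ 2)
          ≤ 1 / Real.log n - 1 / Real.log ((n + 1 : ℕ) : ℝ) := by
        have hle : Real.log n ≤ Real.log ((n + 1 : ℕ) : ℝ) :=
          Real.log_le_log (by linarith) (by push_cast; linarith)
        have e1 : 1 / (((n + 1 : ℕ) : ℝ) * Real.log ((n + 1 : ℕ) : ℝ) ^ 2)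
            = 1 / ((n + 1 : ℕ) : ℝ) / (Real.log ((n + 1 : ℕ) : ℝ) * Real.log ((n + 1 : ℕ) : ℝ)) := by
          field_simp
        have e2 : 1 / Real.log n - 1 / Real.log ((n + 1 : ℕ) : ℝ)
            = (Real.log ((n + 1 : ℕ) : ℝ) - Real.log n)
              / (Real.log n * Real.log ((n + 1 : ℕ) : ℝ)) := by
          field_simp
        rw [e1, e2]
        have : 0 ≤ 1 / ((n + 1 : ℕ) : ℝ) := by positivity
        gcongr
      linarith
  have h0 : ∑ t ∈ Finset.Ioc K n, 1 / f t ≤ ∑ t ∈ Finset.Ioc 2 (max n 2), 1 / f t := by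
    apply Finset.sum_le_sum_of_subset_of_nonneg
    · intro t ht
      simp only [Finset.mem_Ioc] at ht ⊢
      omega
    · intro t _ _
      exact (one_div_pos.2 (f_pos t)).le
  have h1 := key (max n 2) (by omega)
  have h2 : 0 ≤ 1 / Real.log ((max n 2 : ℕ) : ℝ) := by
    apply one_div_nonneg.2
    apply Real.log_nonneg
    exact_mod_cast (by omega : 1 ≤ max n 2)
  have h3 : 1 / Real.log 2 ≤ 3 / 2 := by
    rw [div_le_div_iff₀ hlog2 (by norm_num)]
    linarith [Real.log_two_gt_d9]
  linarith

theorem eta_le {s : ℕ} (hs : 1 ≤ s) : eta s ≤ s := by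
  have h1 := one_le_iota hs
  obtain ⟨j, hj⟩ : ∃ j, iota s = j + 1 := ⟨_, (Nat.sub_add_cancel h1).symm⟩
  have h2 := tau_iota_le s
  have h3 : 1 ≤ Nat.clog 2 (j + 2) := Nat.clog_pos (by norm_num) (by omega)
  rw [hj, tau_succ] at h2
  unfold eta
  rw [hj]
  simp only [Nat.add_sub_cancel]
  omega

theorem card_le_of_forall_le {A : Finset ℕ} {R : ℝ} (hR : 0 ≤ R)
    (h : ∀ s ∈ A, 1 ≤ s ∧ (s : ℝ) ≤ R) : (A.card : ℝ) ≤ R := by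
  have hsub : A ⊆ Finset.Icc 1 ⌊R⌋₊ := fun s hs =>
    Finset.mem_Icc.2 ⟨(h s hs).1, Nat.le_floor (h s hs).2⟩
  have h1 := Finset.card_le_card hsub
  rw [Nat.card_Icc, Nat.add_sub_cancel] at h1
  exact (Nat.cast_le.2 h1).trans (Nat.floor_le hR)

/-! ### Pathwise charging of pulls -/

section Pathwise

variable {K : ℕ} {πa : ArmPolicy K} {πm : MessagePolicy} {x : Fin K → ℕ → ℝ}

theorem armAt_succ (t : ℕ) :
    armAt πa πm x (t + 1) = step πa πm x (t + 1) (pulls πa πm x t) := rfl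

theorem pulls_succ (t : ℕ) (k : Fin K) :
    pulls πa πm x (t + 1) k
      = pulls πa πm x t k + if armAt πa πm x (t + 1) = k then 1 else 0 := rfl

theorem pulls_le_self (t : ℕ) (k : Fin K) : pulls πa πm x t k ≤ t := by
  induction t with
  | zero => exact le_rfl
  | succ t ih => rw [pulls_succ]; split_ifs <;> omega

theorem pulls_mono (k : Fin K) : Monotone fun t => pulls πa πm x t k :=
  monotone_nat_of_le_succ fun t => by simp only [pulls_succ]; omega

theorem sum_gap_armAt (c : Fin K → ℝ) (n : ℕ) :
    ∑ t ∈ Finset.Icc 1 n, c (armAt πa πm x t) = ∑ k, c k * pulls πa πm x n k := by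
  induction n with
  | zero => simp [pulls]
  | succ n ih =>
    rw [Finset.sum_Icc_succ_top (by omega), ih]
    simp only [pulls_succ, Nat.cast_add, mul_add, Finset.sum_add_distrib]
    congr 1
    simp

theorem pulls_of_le {g : ℕ → ℝ → ℕ → ℝ} (hπ : IsIndexPolicy g πa) {t : ℕ} (ht : t ≤ K)
    (k : Fin K) : pulls πa πm x t k = if k.val < t then 1 else 0 := by
  induction t with
  | zero => simp [pulls]
  | succ t ih =>
    rw [pulls_succ, ih (by omega), armAt_succ]
    have h := (hπ (t + 1) (pulls πa πm x t)
      (fun k i => πm (i.val + 1) (fun j => x k j.val)) (by omega)).1 ht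
    change (step πa πm x (t + 1) (pulls πa πm x t)).val + 1 = t + 1 at h
    generalize step πa πm x (t + 1) (pulls πa πm x t) = a at *
    by_cases hk : a = k
    · subst hk
      rw [if_pos rfl, if_neg (by omega), if_pos (by omega)]
    · have : a.val ≠ k.val := fun h => hk (Fin.ext h)
      rw [if_neg hk]
      by_cases h2 : k.val < t
      · rw [if_pos h2, if_pos (by omega)]
      · rw [if_neg h2, if_neg (by omega)]

theorem one_le_pulls {g : ℕ → ℝ → ℕ → ℝ} (hπ : IsIndexPolicy g πa) {t : ℕ} (ht : K ≤ t)
    (k : Fin K) : 1 ≤ pulls πa πm x t k := by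
  refine le_trans ?_ (pulls_mono k ht)
  simp [pulls_of_le hπ le_rfl]

/-- The index of the arm with rewards `x` may be below `y` in round `t`, for some number of samples
up to `n`. -/
def Underestimated (x : ℕ → ℝ) (y : ℝ) (n t : ℕ) : Prop :=
  ∃ s ∈ Finset.Icc 1 n, prefixMean x s < y ∧ Real.log (f t) / s < kl (prefixMean x s) y

/-- Upward rounding moves the estimate towards `y`, so the unrounded mean is at least as far from
`y` in divergence. -/
theorem underestimated_of_gKL_lt {x : ℕ → ℝ} (hx : ∀ i, x i ∈ Set.Icc (0 : ℝ) 1) {y : ℝ}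
    (hy0 : 0 < y) (hy1 : y < 1) {s n t : ℕ} (hs : 1 ≤ s) (hsn : s ≤ n)
    (h : gKL t (decode (fun i : Fin s => packetPolicy (i.val + 1) (fun j => x j.val))) (eta s) < y) :
    Underestimated x y n t := by
  obtain ⟨h1, -, h3⟩ := decode_bounds hx hs
  have h0 := (prefixMean_mem hx (eta s)).1
  obtain ⟨h4, h5⟩ := of_gKL_lt (h0.trans h1) h3 hy0 hy1 h
  exact ⟨eta s, Finset.mem_Icc.2 ⟨eta_pos s, (eta_le hs).trans hsn⟩, h1.trans_lt h4,
    h5.trans_le (kl_antitone_left h0 h1 h4.le hy1)⟩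

/-- One `δ` pays for sampling error and one for rounding. If both suffice, the estimate is at most
`q + 2 * δ`, and reaching `y` then limits the sample size. -/
theorem of_le_gKL {x : ℕ → ℝ} (hx : ∀ i, x i ∈ Set.Icc (0 : ℝ) 1) {q δ y F : ℝ}
    (hδ : 0 < δ) (hq : 0 ≤ q) (hqy : q + 2 * δ < y) (hy1 : y < 1) {s t : ℕ}
    (hs : 1 ≤ s) (ht : Real.log (f t) ≤ F)
    (h : y ≤ gKL t (decode (fun i : Fin s => packetPolicy (i.val + 1) (fun j => x j.val)))
      (eta s)) :
    (eta s : ℝ) ≤ F / kl (q + 2 * δ) y ∨ (iota s : ℝ) + 1 < 1 / δ ∨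
      q + δ ≤ prefixMean x (eta s) := by
  by_contra! hcon
  obtain ⟨c1, c2, c3⟩ := hcon
  obtain ⟨h1, h2, -⟩ := decode_bounds hx hs
  have h0 := (prefixMean_mem hx (eta s)).1
  have c4 : 1 / ((iota s : ℝ) + 1) ≤ δ := by
    rw [div_le_iff₀ (by positivity)]
    rw [div_le_iff₀ hδ] at c2
    linarith
  set v := decode (fun i : Fin s => packetPolicy (i.val + 1) (fun j => x j.val)) with hv
  have h5 : v ≤ q + 2 * δ := by linarith
  have h6 := kl_le_of_le_gKL (h0.trans h1) (h5.trans_lt hqy) hy1 h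
  have h7 := kl_antitone_left (h0.trans h1) h5 hqy.le hy1
  have h8 := two_mul_sq_le_kl (by positivity : 0 ≤ q + 2 * δ) hqy.le (by linarith) hy1
  have h9 : 0 < kl (q + 2 * δ) y := by
    have : 0 < y - (q + 2 * δ) := by linarith
    nlinarith [sq_nonneg (y - (q + 2 * δ)), pow_pos this 2]
  have he : (0 : ℝ) < eta s := by exact_mod_cast eta_pos s
  rw [div_lt_iff₀ h9] at c1
  rw [le_div_iff₀ he] at h6
  nlinarith

open Classical in
/-- Every pull of an arm after the first `K` rounds is charged either to an underestimation of
another arm `b`, or to a failure of the estimate of that arm. -/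
theorem pulls_le (hπ : IsIndexPolicy gKL πa) (hx : ∀ k i, x k i ∈ Set.Icc (0 : ℝ) 1)
    (b k : Fin K) {q δ y : ℝ} (hδ : 0 < δ) (hq : 0 ≤ q) (hqy : q + 2 * δ < y) (hy1 : y < 1)
    {n : ℕ} :
    pulls πa packetPolicy x n k
      ≤ 1 + ((Finset.Ioc K n).filter fun t => Underestimated (x b) y n t).card
        + ((Finset.Icc 1 n).filter fun s =>
          (eta s : ℝ) ≤ Real.log (f n) / kl (q + 2 * δ) y ∨ (iota s : ℝ) + 1 < 1 / δ ∨
            q + δ ≤ prefixMean (x k) (eta s)).card := by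
  set R : ℕ → Prop := fun s => (eta s : ℝ) ≤ Real.log (f n) / kl (q + 2 * δ) y ∨
    (iota s : ℝ) + 1 < 1 / δ ∨ q + δ ≤ prefixMean (x k) (eta s) with hR
  rcases le_total n K with hnK | hKn
  · rw [pulls_of_le hπ hnK]
    split_ifs <;> omega
  -- Failures are counted over the pull counts already left behind. A pull made at count `s` adds
  -- `s` to this window, so distinct pulls pay with distinct counts.
  have key : ∀ m, K ≤ m → m ≤ n → pulls πa packetPolicy x m k
      ≤ 1 + ((Finset.Ioc K m).filter fun t => Underestimated (x b) y n t).card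
        + ((Finset.Ico 1 (pulls πa packetPolicy x m k)).filter R).card := by
    intro m hm
    induction m, hm using Nat.le_induction with
    | base =>
      intro _
      rw [pulls_of_le hπ le_rfl]
      split_ifs <;> omega
    | succ m hm ih =>
      intro hmn
      have ih := ih (by omega)
      have hcard : ((Finset.Ioc K (m + 1)).filter fun t => Underestimated (x b) y n t).card
          = ((Finset.Ioc K m).filter fun t => Underestimated (x b) y n t).card
            + if Underestimated (x b) y n (m + 1) then 1 else 0 := by
        rw [← Finset.insert_Ioc_right_eq_Ioc_add_one (by omega), Finset.filter_insert]
        split_ifs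
        · rw [Finset.card_insert_of_notMem (by simp)]
        · rfl
      rw [pulls_succ, hcard]
      by_cases hA : armAt πa packetPolicy x (m + 1) = k
      · rw [if_pos hA]
        by_cases hU : Underestimated (x b) y n (m + 1)
        · rw [if_pos hU]
          have : ((Finset.Ico 1 (pulls πa packetPolicy x m k)).filter R).card
              ≤ ((Finset.Ico 1 (pulls πa packetPolicy x m k + 1)).filter R).card :=
            Finset.card_le_card (Finset.filter_subset_filter _
              (Finset.Ico_subset_Ico_right (by omega)))
          omega
        · have hb1 := one_le_pulls (πm := packetPolicy) (x := x) hπ hm b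
          have hk1 := one_le_pulls (πm := packetPolicy) (x := x) hπ hm k
          have hmax := (hπ (m + 1) (pulls πa packetPolicy x m)
            (fun k i => packetPolicy (i.val + 1) (fun j => x k j.val)) (by omega)).2 (by omega) b
          rw [show πa (m + 1) (pulls πa packetPolicy x m)
            (fun k i => packetPolicy (i.val + 1) (fun j => x k j.val)) = k from hA] at hmax
          have hby : y ≤ _ := not_lt.1 fun h => hU (underestimated_of_gKL_lt (hx b)
            (by linarith) hy1 hb1 ((pulls_le_self m b).trans (by omega)) h)
          have hRk : R (pulls πa packetPolicy x m k) :=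
            of_le_gKL (hx k) hδ hq hqy hy1 hk1
              (Real.log_le_log (f_pos _) (f_mono (by omega) hmn)) (hby.trans hmax)
          have hcard2 : ((Finset.Ico 1 (pulls πa packetPolicy x m k + 1)).filter R).card
              = ((Finset.Ico 1 (pulls πa packetPolicy x m k)).filter R).card + 1 := by
            rw [← Finset.insert_Ico_right_eq_Ico_add_one hk1, Finset.filter_insert, if_pos hRk,
              Finset.card_insert_of_notMem (by simp)]
          omega
      · rw [if_neg hA, Nat.add_zero]
        omega
  refine (key n hKn le_rfl).trans ?_
  gcongr
  intro s hs
  have := pulls_le_self (πa := πa) (πm := packetPolicy) (x := x) n k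
  simp only [Finset.mem_Ico, Finset.mem_Icc] at hs ⊢
  omega

open Classical in
theorem pulls_le_real (hπ : IsIndexPolicy gKL πa) (hx : ∀ k i, x k i ∈ Set.Icc (0 : ℝ) 1)
    (b k : Fin K) {q δ y : ℝ} (hδ : 0 < δ) (hq : 0 ≤ q) (hqy : q + 2 * δ < y) (hy1 : y < 1)
    {n : ℕ} {U : ℝ} (hU : U = Real.log (f n) / kl (q + 2 * δ) y)
    (hU0 : 0 < U) :
    (pulls πa packetPolicy x n k : ℝ)
      ≤ 1 + (U + 1 + 2 * Real.logb 2 ⌈U⌉) + 1 / δ * (1 / δ + 1) / 2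
        + ∑ t ∈ Finset.Ioc K n, (if Underestimated (x b) y n t then (1 : ℝ) else 0)
        + ∑ s ∈ Finset.Icc 1 n, (if q + δ ≤ prefixMean (x k) (eta s) then (1 : ℝ) else 0) := by
  have h := pulls_le (n := n) hπ hx b k hδ hq hqy hy1
  rw [← hU] at h
  rw [Finset.filter_or, Finset.filter_or] at h
  have h1 := h.trans (Nat.add_le_add_left ((Finset.card_union_le _ _).trans
    (Nat.add_le_add_left (Finset.card_union_le _ _) _)) _)
  have h2 : (((Finset.Icc 1 n).filter fun s => (eta s : ℝ) ≤ U).card : ℝ)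
      ≤ U + 1 + 2 * Real.logb 2 ⌈U⌉ := by
    apply card_le_of_forall_le
    · have : 0 ≤ Real.logb 2 ⌈U⌉ := by
        apply Real.logb_nonneg (by norm_num)
        exact_mod_cast Int.one_le_ceil_iff.2 hU0
      linarith
    · intro s hs
      rw [Finset.mem_filter, Finset.mem_Icc] at hs
      exact ⟨hs.1.1, le_of_eta_le hs.1.1 hs.2⟩
  have h3 : (((Finset.Icc 1 n).filter fun s => (iota s : ℝ) + 1 < 1 / δ).card : ℝ)
      ≤ 1 / δ * (1 / δ + 1) / 2 := by
    apply card_le_of_forall_le (by positivity)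
    intro s hs
    rw [Finset.mem_filter, Finset.mem_Icc] at hs
    exact ⟨hs.1.1, lt_of_iota_succ_lt hs.2⟩
  have h4 : (pulls πa packetPolicy x n k : ℝ) ≤ _ := Nat.cast_le.2 h1
  push_cast at h4
  rw [← Finset.natCast_card_filter, ← Finset.natCast_card_filter]
  linarith

end Pathwise

theorem setOf_underestimated {Ω : Type*} (Y : ℕ → Ω → ℝ) (y : ℝ) (n t : ℕ) :
    {ω | Underestimated (fun i => Y i ω) y n t} = ⋃ s ∈ Finset.Icc 1 n,
      {ω | prefixMean (fun i => Y i ω) s < y ∧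
        Real.log (f t) / s < kl (prefixMean (fun i => Y i ω) s) y} := by
  ext ω
  simp only [Set.mem_iUnion, Set.mem_ofPred_eq, Underestimated, exists_prop]

/-! ### Measurability of the interaction -/

section Measurability

variable {K : ℕ} {Ω : Type*} [MeasurableSpace Ω] {X : Fin K → ℕ → Ω → ℝ}

theorem measurable_Gam (α : ℕ) : Measurable (Gam α) := by
  unfold Gam
  refine Measurable.ite (measurableSet_singleton 0) measurable_const ?_
  exact (Int.measurable_ceil.comp (measurable_const.mul measurable_id)).sub_const 1

theorem measurable_packetPolicy (s : ℕ) : Measurable (packetPolicy s) := by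
  have h : Measurable fun x : Fin s → ℝ => empMean x (1 + tau (iota (s - 1))) := by
    unfold empMean
    fun_prop
  have h2 : Measurable fun z : ℤ => decide (z = 1) := Measurable.of_discrete
  exact h2.comp (((measurable_Gam _).comp h).sub (((measurable_Gam _).comp h).const_mul 2))

/-- The arm policy is arbitrary, but for a fixed `T` its input ranges over finitely many bit
patterns. Random pull counts are then handled by countability. -/
theorem measurable_step (πa : ArmPolicy K) (hX : ∀ k i, Measurable (X k i)) (t : ℕ)
    (T : Fin K → ℕ) : Measurable fun ω => step πa packetPolicy (fun k i => X k i ω) t T := by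
  have h : Measurable fun ω => (fun k i => packetPolicy (i.val + 1) (fun j => X k j.val ω) :
      (k : Fin K) → Fin (T k) → Bool) := by
    refine measurable_pi_lambda _ fun k => measurable_pi_lambda _ fun i => ?_
    exact (measurable_packetPolicy _).comp (measurable_pi_lambda _ fun j => hX k _)
  exact (Measurable.of_discrete (f := πa t T)).comp h

theorem measurable_pulls (πa : ArmPolicy K) (hX : ∀ k i, Measurable (X k i)) (t : ℕ) :
    Measurable fun ω => pulls πa packetPolicy (fun k i => X k i ω) t := by
  induction t with
  | zero => exact measurable_const
  | succ t ih =>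
    have h : Measurable fun ω => step πa packetPolicy (fun k i => X k i ω) (t + 1)
        (pulls πa packetPolicy (fun k i => X k i ω) t) := by
      have h2 : Measurable fun p : (Fin K → ℕ) × Ω =>
          step πa packetPolicy (fun k i => X k i p.2) (t + 1) p.1 :=
        measurable_from_prod_countable_right fun T => measurable_step πa hX (t + 1) T
      exact h2.comp (ih.prodMk measurable_id)
    refine measurable_pi_lambda _ fun k => ?_
    refine ((measurable_pi_apply k).comp ih).add ?_
    exact Measurable.ite (h (measurableSet_singleton k)) measurable_const measurable_const

theorem measurable_armAt (πa : ArmPolicy K) (hX : ∀ k i, Measurable (X k i)) (t : ℕ) :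
    Measurable fun ω => armAt πa packetPolicy (fun k i => X k i ω) t := by
  have h2 : Measurable fun p : (Fin K → ℕ) × Ω =>
      step πa packetPolicy (fun k i => X k i p.2) t p.1 :=
    measurable_from_prod_countable_right fun T => measurable_step πa hX t T
  exact h2.comp ((measurable_pulls πa hX (t - 1)).prodMk measurable_id)

theorem measurable_prefixMean {Y : ℕ → Ω → ℝ} (hY : ∀ i, Measurable (Y i)) (s : ℕ) :
    Measurable fun ω => prefixMean (fun i => Y i ω) s := by
  unfold prefixMean
  fun_prop

theorem measurableSet_underestimated {Y : ℕ → Ω → ℝ} (hY : ∀ i, Measurable (Y i)) {y : ℝ}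
    (h0 : 0 < y) (h1 : y < 1) (n t : ℕ) :
    MeasurableSet {ω | Underestimated (fun i => Y i ω) y n t} := by
  rw [setOf_underestimated]
  refine Finset.measurableSet_biUnion _ fun s _ => ?_
  exact (measurableSet_lt (measurable_prefixMean hY s) measurable_const).inter
    (measurableSet_lt measurable_const
      ((continuous_kl_left h0 h1).measurable.comp (measurable_prefixMean hY s)))

end Measurability

/-! ### Expected number of pulls -/

section Expectation

variable {K : ℕ} {Ω : Type*} [MeasurableSpace Ω] {P : Measure Ω} [IsProbabilityMeasure P]

/-- With `L = log f(t) / s` the exponent splits into `-log f(t)`, free of `s`, and a part linear in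
`s` that sums geometrically. -/
theorem prob_underestimated_le {Y : ℕ → Ω → ℝ} {m : ℝ} (hm : ∀ i, Measurable (Y i))
    (hb : ∀ i, ∀ᵐ ω ∂P, Y i ω ∈ Set.Icc (0 : ℝ) 1) (hind : iIndepFun Y P)
    (hmean : ∀ i, ∫ ω, Y i ω ∂P = m) {y : ℝ} (hy : 0 < y) (hym : y < m) (hm1 : m < 1) (n t : ℕ) :
    P.real {ω | Underestimated (fun i => Y i ω) y n t} ≤ 1 / f t * (1 / (2 * (m - y) ^ 2)) := by
  rw [setOf_underestimated]
  calc _ ≤ ∑ s ∈ Finset.Icc 1 n, P.real {ω | prefixMean (fun i => Y i ω) s < y ∧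
        Real.log (f t) / s < kl (prefixMean (fun i => Y i ω) s) y} :=
        measureReal_biUnion_finset_le _ _
    _ ≤ ∑ s ∈ Finset.Icc 1 n, 1 / f t * Real.exp (-(2 * (m - y) ^ 2) * s) := by
        refine Finset.sum_le_sum fun s hs => ?_
        rw [Finset.mem_Icc] at hs
        refine (prob_lt_kl_prefixMean hm hb hind hmean hy hym hm1 hs.1 _).trans (le_of_eq ?_)
        have hs0 : (s : ℝ) ≠ 0 := by
          have := hs.1
          positivity
        rw [one_div, ← Real.exp_log (f_pos t), ← Real.exp_neg, ← Real.exp_add, Real.log_exp]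
        congr 1
        field_simp
        ring
    _ = 1 / f t * ∑ s ∈ Finset.Icc 1 n, Real.exp (-(2 * (m - y) ^ 2) * s) := by
        rw [Finset.mul_sum]
    _ ≤ _ := by
        have := f_pos t
        have h2 : 0 < 2 * (m - y) ^ 2 := by
          have : 0 < m - y := by linarith
          positivity
        gcongr
        exact sum_exp_neg_le h2 n

theorem integral_pulls_le {X : Fin K → ℕ → Ω → ℝ} {μ : Fin K → ℝ} {πa : ArmPolicy K}
    (hK : 2 ≤ K) (hX : ∀ k i, Measurable (X k i))
    (hb : ∀ k i, ∀ᵐ ω ∂P, X k i ω ∈ Set.Icc (0 : ℝ) 1)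
    (hind : ∀ k, iIndepFun (fun i => X k i) P) (hmean : ∀ k i, ∫ ω, X k i ω ∂P = μ k)
    (hπ : IsIndexPolicy gKL πa) (b k : Fin K) {δ y : ℝ} (hδ : 0 < δ) (hq : 0 ≤ μ k)
    (hqy : μ k + 2 * δ < y) (hym : y < μ b) (hb1 : μ b < 1) {n : ℕ}
    {U : ℝ} (hU : U = Real.log (f n) / kl (μ k + 2 * δ) y)
    (hU0 : 0 < U) :
    ∫ ω, (pulls πa packetPolicy (fun k i => X k i ω) n k : ℝ) ∂P
      ≤ 1 + (U + 1 + 2 * Real.logb 2 ⌈U⌉) + 1 / δ * (1 / δ + 1) / 2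
        + 3 / 2 * (1 / (2 * (μ b - y) ^ 2)) + 1 / δ ^ 2 := by
  classical
  have hy0 : 0 < y := by linarith
  have hy1 : y < 1 := hym.trans hb1
  have hall : ∀ᵐ ω ∂P, ∀ k i, X k i ω ∈ Set.Icc (0 : ℝ) 1 :=
    ae_all_iff.2 fun k => ae_all_iff.2 fun i => hb k i
  set c : ℝ := 1 + (U + 1 + 2 * Real.logb 2 ⌈U⌉) + 1 / δ * (1 / δ + 1) / 2
  have hE : ∀ t, MeasurableSet {ω | Underestimated (fun i => X b i ω) y n t} := fun t =>
    measurableSet_underestimated (hX b) hy0 hy1 n t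
  have hD : ∀ s, MeasurableSet {ω | μ k + δ ≤ prefixMean (fun i => X k i ω) (eta s)} := fun s =>
    measurableSet_le measurable_const (measurable_prefixMean (hX k) _)
  have hind1 : ∀ (p : Ω → Prop) [DecidablePred p], MeasurableSet {ω | p ω} →
      Integrable (fun ω => if p ω then (1 : ℝ) else 0) P ∧
      ∫ ω, (if p ω then (1 : ℝ) else 0) ∂P = P.real {ω | p ω} := by
    intro p _ hp
    have e : (fun ω => if p ω then (1 : ℝ) else 0) = {ω | p ω}.indicator 1 := by
      ext ω
      simp [Set.indicator_apply]
    rw [e]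
    exact ⟨(integrable_const 1).indicator hp, integral_indicator_one hp⟩
  have hpm : Measurable fun ω => (pulls πa packetPolicy (fun k i => X k i ω) n k : ℝ) :=
    (Measurable.of_discrete (f := fun m : ℕ => (m : ℝ))).comp
      ((measurable_pi_apply k).comp (measurable_pulls πa hX n))
  have hpi : Integrable (fun ω => (pulls πa packetPolicy (fun k i => X k i ω) n k : ℝ)) P := by
    refine Integrable.of_mem_Icc 0 n hpm.aemeasurable (ae_of_all _ fun ω => ?_)
    exact ⟨by positivity, by exact_mod_cast pulls_le_self n k⟩
  have hi1 : Integrable (fun ω => ∑ t ∈ Finset.Ioc K n,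
      (if Underestimated (fun i => X b i ω) y n t then (1 : ℝ) else 0)) P :=
    integrable_finsetSum _ fun t _ => (hind1 _ (hE t)).1
  have hi2 : Integrable (fun ω => ∑ s ∈ Finset.Icc 1 n,
      (if μ k + δ ≤ prefixMean (fun i => X k i ω) (eta s) then (1 : ℝ) else 0)) P :=
    integrable_finsetSum _ fun s _ => (hind1 _ (hD s)).1
  have h1 := integral_mono_ae hpi (((integrable_const c).add hi1).add hi2) (by
    filter_upwards [hall] with ω hω
    exact pulls_le_real hπ hω b k hδ hq hqy hy1 hU hU0)
  refine h1.trans ?_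
  rw [integral_add' ((integrable_const c).add hi1) hi2, integral_add' (integrable_const c) hi1,
    integral_finsetSum _ fun t _ => (hind1 _ (hE t)).1,
    integral_finsetSum _ fun s _ => (hind1 _ (hD s)).1]
  simp only [integral_const, probReal_univ, smul_eq_mul, one_mul]
  have h2 : ∑ t ∈ Finset.Ioc K n,
      ∫ ω, (if Underestimated (fun i => X b i ω) y n t then (1 : ℝ) else 0) ∂P
      ≤ 3 / 2 * (1 / (2 * (μ b - y) ^ 2)) := by
    calc _ ≤ ∑ t ∈ Finset.Ioc K n, 1 / f t * (1 / (2 * (μ b - y) ^ 2)) := by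
          refine Finset.sum_le_sum fun t _ => ?_
          rw [(hind1 _ (hE t)).2]
          exact prob_underestimated_le (hX b) (hb b) (hind b) (hmean b) hy0 hym hb1 n t
      _ = (∑ t ∈ Finset.Ioc K n, 1 / f t) * (1 / (2 * (μ b - y) ^ 2)) := by
          rw [Finset.sum_mul]
      _ ≤ _ := by
          gcongr
          exact sum_inv_f_le hK
  have h3 : ∑ s ∈ Finset.Icc 1 n,
      ∫ ω, (if μ k + δ ≤ prefixMean (fun i => X k i ω) (eta s) then (1 : ℝ) else 0) ∂P
      ≤ 1 / δ ^ 2 := by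
    calc _ ≤ ∑ s ∈ Finset.Icc 1 n, Real.exp (-δ ^ 2 * s) := by
          refine Finset.sum_le_sum fun s hs => ?_
          rw [Finset.mem_Icc] at hs
          rw [(hind1 _ (hD s)).2]
          refine (prob_le_prefixMean (hX k) (hb k) (hind k) (hmean k) hδ.le (eta_pos s)).trans ?_
          apply Real.exp_le_exp.2
          -- The factor `2` in Hoeffding's exponent exactly pays for the delay.
          have : (s : ℝ) ≤ 2 * eta s := by exact_mod_cast le_two_mul_eta hs.1
          nlinarith [sq_nonneg δ]
      _ ≤ _ := sum_exp_neg_le (by positivity) n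
  linarith

end Expectation

/-! ### Constants and the size of the lower-order terms -/

section Arithmetic

variable {n : ℕ}

theorem log_ge_of_two_le (hn : 2 ≤ n) : 0.6931 ≤ Real.log n := by
  have : Real.log 2 ≤ Real.log n := Real.log_le_log (by norm_num) (by exact_mod_cast hn)
  linarith [Real.log_two_gt_d9]

theorem cube_rpow_log (hn : 2 ≤ n) : (Real.log n ^ (1 / 3 : ℝ)) ^ 3 = Real.log n := by
  have h := log_ge_of_two_le hn
  rw [← Real.rpow_natCast, ← Real.rpow_mul (by linarith)]
  norm_num

theorem sq_rpow_log (hn : 2 ≤ n) :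
    (Real.log n ^ (1 / 3 : ℝ)) ^ 2 = Real.log n ^ (2 / 3 : ℝ) := by
  have h := log_ge_of_two_le hn
  rw [← Real.rpow_natCast, ← Real.rpow_mul (by linarith)]
  norm_num

/-- Since `0.88 ^ 3 < 0.6931 < log 2`. This keeps `C n - 2` away from zero and fixes the numerical
constants below. -/
theorem rpow_log_ge (hn : 2 ≤ n) : 0.88 ≤ Real.log n ^ (1 / 3 : ℝ) := by
  have h := log_ge_of_two_le hn
  rw [← cube_rpow_log hn] at h
  by_contra! hlt
  have h0 : 0 ≤ Real.log n ^ (1 / 3 : ℝ) :=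
    Real.rpow_nonneg (by linarith [log_ge_of_two_le hn]) _
  have := pow_le_pow_left₀ h0 hlt.le 3
  norm_num at this h
  linarith

theorem log_f_pos (hn : 2 ≤ n) : 0 < Real.log (f n) := by
  apply Real.log_pos
  unfold f
  have h := log_ge_of_two_le hn
  have : 0 < Real.log n := by linarith
  have : (0 : ℝ) < n := by positivity
  have : 0 < (n : ℝ) * Real.log n ^ 2 := by positivity
  linarith

theorem log_one_add_sq_le {x : ℝ} (hx : 0 ≤ x) : Real.log (1 + x ^ 2) ≤ x := by
  rw [Real.log_le_iff_le_exp (by positivity)]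
  have h := Real.sum_le_exp_of_nonneg hx 4
  simp only [Finset.sum_range_succ, Finset.sum_range_zero, Nat.factorial] at h
  norm_num at h
  nlinarith [mul_nonneg hx (sq_nonneg (x - 3 / 2)), pow_nonneg hx 3]

theorem log_f_le (hn : 2 ≤ n) : Real.log (f n) ≤ 2 * Real.log n := by
  have h := log_ge_of_two_le hn
  have hn1 : (1 : ℝ) ≤ n := by exact_mod_cast (by omega : 1 ≤ n)
  have h1 : f n ≤ n * (1 + Real.log n ^ 2) := by unfold f; nlinarith
  have h2 := Real.log_le_log (f_pos n) h1
  rw [Real.log_mul (by positivity) (by positivity)] at h2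
  linarith [log_one_add_sq_le (show 0 ≤ Real.log n by linarith)]

/-- The cost of shifting the means is linear in `B`. The inequality `2ab ≤ a² + b²` splits it into
the first lower-order term and a remainder free of `B`, controlled by `F ≤ 2 * w ^ 3`. -/
theorem kl_excess_le {F C' D B w : ℝ} (hw : 0.88 ≤ w) (hC : C' = 2 + w) (hD : 0 < D)
    (hF0 : 0 < F) (hF : F ≤ 2 * w ^ 3) :
    F * B * C' / (2 * D ^ 2 * w ^ 2)
      ≤ B ^ 2 * F / (C' * D ^ 2 * (2 - 1 / C') ^ 2) + 1.64 * (C' / D) ^ 2 := by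
  have hw0 : 0 < w := by linarith
  have hC0 : 0 < C' := by linarith
  have h2C : 0 < 2 * C' - 1 := by linarith
  have e1 : B ^ 2 * F / (C' * D ^ 2 * (2 - 1 / C') ^ 2)
      = F * C' / D ^ 2 * (B / (2 * C' - 1)) ^ 2 := by
    have : 2 - 1 / C' = (2 * C' - 1) / C' := by field_simp
    rw [this]
    field_simp
  have e2 : F * B * C' / (2 * D ^ 2 * w ^ 2)
      = F * C' / D ^ 2 * (2 * (B / (2 * C' - 1)) * ((2 * C' - 1) / (4 * w ^ 2))) := by
    generalize 2 * C' - 1 = E at h2C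
    field_simp
    ring
  have h1 : F * C' / D ^ 2 * (2 * (B / (2 * C' - 1)) * ((2 * C' - 1) / (4 * w ^ 2)))
      ≤ F * C' / D ^ 2 * ((B / (2 * C' - 1)) ^ 2 + ((2 * C' - 1) / (4 * w ^ 2)) ^ 2) := by
    have : 0 ≤ F * C' / D ^ 2 := by positivity
    exact mul_le_mul_of_nonneg_left (two_mul_le_add_sq _ _) this
  have h2 : F * C' / D ^ 2 * ((2 * C' - 1) / (4 * w ^ 2)) ^ 2 ≤ 1.64 * (C' / D) ^ 2 := by
    calc F * C' / D ^ 2 * ((2 * C' - 1) / (4 * w ^ 2)) ^ 2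
        ≤ 2 * w ^ 3 * C' / D ^ 2 * ((2 * C') / (4 * w ^ 2)) ^ 2 := by
          gcongr
          linarith
      _ = (C' / (2 * w)) * (C' / D) ^ 2 := by field_simp; ring
      _ ≤ 1.64 * (C' / D) ^ 2 := by
          gcongr
          -- `C' / (2 * w) = 1 / w + 1 / 2`, which is below `1.64` once `w ≥ 0.88`.
          rw [div_le_iff₀ (by positivity)]
          linarith
  rw [e1, e2]
  linarith

theorem gap_mul_pulls_bound_le {p q : ℝ} (hq : 0 < q) (hqp : q < p) (hp : p < 1) (hn : 2 ≤ n)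
    {ε U : ℝ} (hε : ε = (p - q) / C n) (hU : U = Real.log (f n) / kl (q + ε) (p - ε)) :
    0 < U ∧ (p - q) * (1 + (U + 1 + 2 * Real.logb 2 ⌈U⌉) + 2 / ε * (2 / ε + 1) / 2
        + 3 / 2 * (1 / (2 * ε ^ 2)) + 4 / ε ^ 2)
      ≤ (p - q) * Real.log (f n) / kl q p + lowerOrder p q n := by
  have hw := rpow_log_ge hn
  have hF := log_f_le hn
  have hF0 := log_f_pos hn
  rw [← cube_rpow_log hn] at hF
  have hCn : C n = 2 + Real.log n ^ (1 / 3 : ℝ) := rfl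
  unfold lowerOrder
  set w : ℝ := Real.log n ^ (1 / 3 : ℝ)
  set F : ℝ := Real.log (f n)
  set C' : ℝ := C n
  set D : ℝ := p - q with hD
  set B : ℝ := 1 / q + 1 / (1 - p)
  have hw0 : 0 < w := by linarith
  have hC0 : 0 < C' := by linarith
  have hC2 : 2.88 ≤ C' := by linarith
  have hD0 : 0 < D := by linarith
  have hD1 : D < 1 := by linarith
  have hε0 : 0 < ε := by rw [hε]; positivity
  have hεC : ε * C' = D := by rw [hε]; field_simp
  have hε2 : 2 * ε < D := by nlinarith
  have hgap : (p - ε) - (q + ε) = D * (w / C') := by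
    have : w / C' = 1 - 2 / C' := by rw [hCn]; field_simp; ring
    rw [this, hε]
    field_simp
    rw [hD]; ring
  have hd : 2 * D ^ 2 ≤ kl q p := two_mul_sq_le_kl hq.le hqp.le (by linarith) hp
  have hd' : 2 * D ^ 2 * (w / C') ^ 2 ≤ kl (q + ε) (p - ε) := by
    have := two_mul_sq_le_kl (p := q + ε) (q := p - ε) (by linarith) (by linarith) (by linarith)
      (by linarith)
    rw [hgap] at this
    linarith [mul_pow D (w / C') 2]
  have hdd : kl q p - kl (q + ε) (p - ε) ≤ 2 * D ^ 2 * B / C' := by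
    have := kl_sub_kl_le hq hp hε0.le (by linarith)
    refine this.trans (le_of_eq ?_)
    rw [hε]
    ring
  have hd0 : 0 < kl q p := lt_of_lt_of_le (by positivity) hd
  have hd'0 : 0 < kl (q + ε) (p - ε) := lt_of_lt_of_le (by positivity) hd'
  have hU0 : 0 < U := by rw [hU]; positivity
  refine ⟨hU0, ?_⟩
  have hB : 0 ≤ B := by
    have : 0 < 1 - p := by linarith
    positivity
  -- The difference of reciprocals has numerator bounded by `hdd`; Pinsker bounds both divergences
  -- in the denominator from below.
  have hexcess : U - F / kl q p ≤ F * B * C' / (2 * D ^ 2 * w ^ 2) := by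
    have e : U - F / kl q p
        = F * (kl q p - kl (q + ε) (p - ε)) / (kl q p * kl (q + ε) (p - ε)) := by
      rw [hU]; field_simp
    rw [e]
    calc _ ≤ F * (2 * D ^ 2 * B / C') / (kl q p * kl (q + ε) (p - ε)) := by gcongr
      _ ≤ F * (2 * D ^ 2 * B / C') / (2 * D ^ 2 * (2 * D ^ 2 * (w / C') ^ 2)) := by gcongr
      _ = _ := by field_simp
  have hmain := kl_excess_le (B := B) hw hCn hD0 hF0 hF
  set V : ℝ := F / (2 * D ^ 2 * (1 - 2 / C') ^ 2) with hV
  have hUV : U ≤ V := by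
    have : w / C' = 1 - 2 / C' := by rw [hCn]; field_simp; ring
    rw [hU, hV, ← this]
    gcongr
  have hXsq : 4 * C' ^ 2 / D ^ 2 = 4 * (C' / D) ^ 2 := by rw [div_pow]; ring
  have hX : 2.88 ≤ C' / D := by
    rw [le_div_iff₀ hD0]; nlinarith
  set M : ℝ := max (⌈V⌉ : ℝ) (4 * C' ^ 2 / D ^ 2)
  have hM4 : 4 ≤ M := by
    refine le_trans ?_ (le_max_right _ _)
    rw [hXsq]; nlinarith
  have hM2 : 2 ≤ Real.logb 2 M := by
    rw [Real.le_logb_iff_rpow_le (by norm_num) (by linarith)]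
    norm_num
    exact hM4
  have hMU : Real.logb 2 ⌈U⌉ ≤ Real.logb 2 M := by
    have h0 : (0 : ℝ) < ⌈U⌉ := by exact_mod_cast Int.ceil_pos.2 hU0
    apply Real.logb_le_logb_of_le (by norm_num) h0
    refine le_trans ?_ (le_max_left _ _)
    exact_mod_cast Int.ceil_mono hUV
  have e1 : 2 / ε = 2 * (C' / D) := by rw [hε]; field_simp
  have e2 : 3 / 2 * (1 / (2 * ε ^ 2)) = 3 / 4 * (C' / D) ^ 2 := by rw [hε]; field_simp; norm_num
  have e3 : 4 / ε ^ 2 = 4 * (C' / D) ^ 2 := by rw [hε]; field_simp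
  rw [e1, e2, e3]
  -- The multiples of `(C' / D) ^ 2` are `2`, `3/4`, `4` and `1.64`; with the linear term absorbed
  -- they stay below `10`. The constant `2` fits in the spare `5/4` of the logarithm, as `M ≥ 4`.
  have hcore : 1 + (U + 1 + 2 * Real.logb 2 ⌈U⌉) + 2 * (C' / D) * (2 * (C' / D) + 1) / 2
        + 3 / 4 * (C' / D) ^ 2 + 4 * (C' / D) ^ 2
      ≤ F / kl q p + (B ^ 2 * F / (C' * D ^ 2 * (2 - 1 / C') ^ 2) + 10 * (C' / D) ^ 2
        + 13 / 4 * Real.logb 2 M) := by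
    have hX2 : 2.88 * (C' / D) ≤ (C' / D) ^ 2 := by
      rw [sq]
      exact mul_le_mul_of_nonneg_right hX (by linarith)
    have hexp : 2 * (C' / D) * (2 * (C' / D) + 1) / 2 = 2 * (C' / D) ^ 2 + C' / D := by ring
    rw [hexp]
    linarith
  refine (mul_le_mul_of_nonneg_left hcore hD0.le).trans (le_of_eq ?_)
  have h2C : 2 - 1 / C' ≠ 0 := by
    have : 1 / C' ≤ 1 := by rw [div_le_one hC0]; linarith
    intro h; linarith
  rw [mul_add, mul_add, mul_add]
  congr 1
  · ring
  · congr 1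
    · congr 1
      · field_simp
      · field_simp
    · ring

theorem lowerOrder_nonneg {p q : ℝ} (hqp : q < p) (hn : 2 ≤ n) : 0 ≤ lowerOrder p q n := by
  have hF0 := log_f_pos hn
  have hw := rpow_log_ge hn
  have hD0 : 0 < p - q := by linarith
  have hC0 : 0 < C n := by unfold C; linarith
  unfold lowerOrder
  set V : ℝ := Real.log (f n) / (2 * (p - q) ^ 2 * (1 - 2 / C n) ^ 2)
  have hM : 0 ≤ Real.logb 2 (max (⌈V⌉ : ℝ) (4 * C n ^ 2 / (p - q) ^ 2)) := by
    have hCD : (0 : ℝ) < 2 - 0 := by norm_num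
    have hV : 0 < V := by
      have : 0 < 1 - 2 / C n := by
        rw [sub_pos, div_lt_one hC0]; unfold C; linarith
      positivity
    apply Real.logb_nonneg (by norm_num)
    refine le_trans ?_ (le_max_left _ _)
    exact_mod_cast Int.one_le_ceil_iff.2 hV
  positivity

/-- Each term is of order `w ^ 2 / D`, with `642 = 2 + 160 + 480`. The logarithm may be bounded
crudely by its argument's square root, since `M ≤ (3 * Z) ^ 2` with `Z = C' ^ 2 / D`. -/
theorem lowerOrder_terms_le {F C' D B w : ℝ} (hw : 0.88 ≤ w) (hCn : C' = 2 + w) (hD0 : 0 < D)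
    (hD1 : D < 1) (hB : 1 ≤ B) (hF : F ≤ 2 * w ^ 3) :
    B ^ 2 * F / (C' * D * (2 - 1 / C') ^ 2) + 10 * C' ^ 2 / D
        + 13 * D / 4 * Real.logb 2
          (max (⌈F / (2 * D ^ 2 * (1 - 2 / C') ^ 2)⌉ : ℝ) (4 * C' ^ 2 / D ^ 2))
      ≤ 642 * B ^ 2 * (w ^ 2 / D) := by
  have hw0 : 0 < w := by linarith
  have hC0 : 0 < C' := by linarith
  have h4 : C' ≤ 4 * w := by linarith
  have t1 : B ^ 2 * F / (C' * D * (2 - 1 / C') ^ 2) ≤ 2 * B ^ 2 * (w ^ 2 / D) := by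
    have h2C : 1 ≤ 2 - 1 / C' := by
      have : 1 / C' ≤ 1 := by rw [div_le_one hC0]; linarith
      linarith
    calc _ ≤ B ^ 2 * (2 * w ^ 3) / (w * D * 1 ^ 2) := by
          gcongr
          linarith
      _ = _ := by field_simp
  have tC : C' ^ 2 / D ≤ 16 * (w ^ 2 / D) := by
    calc C' ^ 2 / D ≤ (4 * w) ^ 2 / D := by gcongr
      _ = _ := by ring
  have t2 : 10 * C' ^ 2 / D ≤ 160 * (w ^ 2 / D) := by
    rw [mul_div_assoc]; linarith
  set V : ℝ := F / (2 * D ^ 2 * (1 - 2 / C') ^ 2) with hV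
  set M : ℝ := max (⌈V⌉ : ℝ) (4 * C' ^ 2 / D ^ 2)
  set Z : ℝ := C' ^ 2 / D with hZ
  have hZ0 : 0 < Z := by positivity
  have hC1 : 1 ≤ C' := by linarith
  have hZ1 : 1 ≤ Z := by
    rw [hZ, le_div_iff₀ hD0]; nlinarith
  have hM0 : 0 < M := lt_of_lt_of_le (by positivity) (le_max_right _ _)
  have hMZ : M ≤ (3 * Z) ^ 2 := by
    apply max_le
    · have h1 : V ≤ Z ^ 2 := by
        have : 1 - 2 / C' = w / C' := by rw [hCn]; field_simp; ring
        rw [hV, this]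
        calc F / (2 * D ^ 2 * (w / C') ^ 2) ≤ 2 * w ^ 3 / (2 * D ^ 2 * (w / C') ^ 2) := by gcongr
          _ = w * C' ^ 2 / D ^ 2 := by field_simp
          _ ≤ C' ^ 2 * C' ^ 2 / D ^ 2 := by
              gcongr
              nlinarith
          _ = Z ^ 2 := by rw [hZ]; ring
      have h2 := (Int.ceil_lt_add_one V).le
      nlinarith
    · have h1 : 1 ≤ C' ^ 2 := one_le_pow₀ hC1
      calc 4 * C' ^ 2 / D ^ 2 ≤ 9 * (C' ^ 2 * C' ^ 2) / D ^ 2 :=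
            div_le_div_of_nonneg_right (by nlinarith) (by positivity)
        _ = (3 * Z) ^ 2 := by rw [hZ]; ring
  have hlog : Real.logb 2 M ≤ 9 * Z := by
    have h1 : Real.log M ≤ 2 * (3 * Z) := by
      calc Real.log M ≤ Real.log ((3 * Z) ^ 2) := Real.log_le_log hM0 hMZ
        _ = 2 * Real.log (3 * Z) := by rw [Real.log_pow]; norm_num
        _ ≤ 2 * (3 * Z) := by
            have := Real.log_le_sub_one_of_pos (show 0 < 3 * Z by positivity)
            linarith
    have h2 := Real.log_two_gt_d9
    rw [← Real.log_div_log, div_le_iff₀ (by linarith)]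
    nlinarith
  have t3 : 13 * D / 4 * Real.logb 2 M ≤ 480 * (w ^ 2 / D) := by
    calc 13 * D / 4 * Real.logb 2 M ≤ 13 * D / 4 * (9 * Z) := by gcongr
      _ ≤ 13 * 1 / 4 * (9 * Z) := by gcongr
      _ ≤ _ := by linarith
  have hwD : 0 < w ^ 2 / D := by positivity
  have hB2 : 1 ≤ B ^ 2 := one_le_pow₀ hB
  nlinarith

theorem lowerOrder_le {p q : ℝ} (hq : 0 < q) (hqp : q < p) (hp : p < 1) (hn : 2 ≤ n) :
    lowerOrder p q n
      ≤ 642 * (1 / q + 1 / (1 - p)) ^ 2 * (Real.log n ^ (2 / 3 : ℝ) / (p - q)) := by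
  have hF := log_f_le hn
  rw [← cube_rpow_log hn] at hF
  rw [← sq_rpow_log hn]
  have h1 : 1 ≤ 1 / q := by rw [le_div_iff₀ hq]; linarith
  have h2 : 0 < 1 / (1 - p) := one_div_pos.2 (by linarith)
  exact lowerOrder_terms_le (rpow_log_ge hn) rfl (by linarith) (by linarith) (by linarith)
    hF

end Arithmetic

/-! ### Regret decomposition and conclusion -/

theorem regret_eq {K : ℕ} {Ω : Type*} [MeasurableSpace Ω] {P : Measure Ω} [IsProbabilityMeasure P]
    {X : Fin K → ℕ → Ω → ℝ} (hX : ∀ k i, Measurable (X k i)) (μ : Fin K → ℝ) (πa : ArmPolicy K)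
    {b : Fin K} (hb : ∀ k, μ k ≤ μ b) (n : ℕ) :
    regret P X μ πa packetPolicy n = ∑ k ∈ Finset.univ.erase b,
      (μ b - μ k) * ∫ ω, (pulls πa packetPolicy (fun k i => X k i ω) n k : ℝ) ∂P := by
  have hsup : ⨆ k, μ k = μ b := by
    have : Nonempty (Fin K) := ⟨b⟩
    exact le_antisymm (ciSup_le hb) (le_ciSup (Set.finite_range μ).bddAbove b)
  have hpi : ∀ k, Integrable
      (fun ω => (pulls πa packetPolicy (fun k i => X k i ω) n k : ℝ)) P := by
    intro k
    have hpm : Measurable fun ω => (pulls πa packetPolicy (fun k i => X k i ω) n k : ℝ) :=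
      (Measurable.of_discrete (f := fun m : ℕ => (m : ℝ))).comp
        ((measurable_pi_apply k).comp (measurable_pulls πa hX n))
    refine Integrable.of_mem_Icc 0 n hpm.aemeasurable (ae_of_all _ fun ω => ?_)
    exact ⟨by positivity, by exact_mod_cast pulls_le_self n k⟩
  unfold regret
  rw [hsup, ← integral_finsetSum]
  · simp_rw [sum_gap_armAt (fun k => μ b - μ k)]
    rw [integral_finsetSum _ fun k _ => (hpi k).const_mul _]
    simp_rw [integral_const_mul]
    rw [← Finset.add_sum_erase _ _ (Finset.mem_univ b)]
    simp
  · intro t _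
    have hm : Measurable fun ω => μ b - μ (armAt πa packetPolicy (fun k i => X k i ω) t) :=
      (Measurable.of_discrete (f := fun k => μ b - μ k)).comp (measurable_armAt πa hX t)
    refine Integrable.of_mem_Icc 0 (∑ k, (μ b - μ k)) hm.aemeasurable (ae_of_all _ fun ω => ?_)
    exact ⟨sub_nonneg.2 (hb _), Finset.single_le_sum (f := fun k => μ b - μ k)
      (fun k _ => sub_nonneg.2 (hb k)) (Finset.mem_univ _)⟩

end OneBitBandit

theorem corollary2 :
    ∃ c : ℝ, 0 < c ∧
      ∀ (K : ℕ) (hK : 2 ≤ K)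
        (Ω : Type*) [MeasurableSpace Ω] (P : Measure Ω) [IsProbabilityMeasure P]
        (ν : Fin K → Measure ℝ) (X : Fin K → ℕ → Ω → ℝ) (μ : Fin K → ℝ)
        (πa : OneBitBandit.ArmPolicy K) (one two last : Fin K),
        one = ⟨0, by omega⟩ → two = ⟨1, by omega⟩ → last = ⟨K - 1, by omega⟩ →
        -- the reward distributions live on the unit interval
        (∀ k, IsProbabilityMeasure (ν k)) → (∀ k, ν k (Set.Icc 0 1) = 1) →
        -- the rewards of each arm are i.i.d.
        (∀ k i, Measurable (X k i)) → (∀ k i, P.map (X k i) = ν k) →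
        (∀ k, iIndepFun (fun i => X k i) P) →
        -- the means, sorted, with a unique best arm
        (∀ k, μ k = ∫ x, x ∂(ν k)) →
        Antitone μ → μ two < μ one → 0 < μ last → μ one < 1 →
        OneBitBandit.IsIndexPolicy OneBitBandit.gKL πa →
        ∀ n : ℕ, 2 ≤ n →
          OneBitBandit.regret P X μ πa OneBitBandit.packetPolicy n
            ≤ ∑ k ∈ Finset.univ.erase one,
                ((μ one - μ k) * Real.log (OneBitBandit.f n)
                    / (OneBitBandit.d (μ k) (μ one)).toReal
                  + OneBitBandit.lowerOrder (μ one) (μ k) n)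
          ∧ |∑ k ∈ Finset.univ.erase one, OneBitBandit.lowerOrder (μ one) (μ k) n|
              ≤ c * (1 / μ last + 1 / (1 - μ one)) ^ 2
                  * (K * Real.log n ^ (2 / 3 : ℝ) / (μ one - μ two))
          ∧ ∀ k, k ≠ one →
              (OneBitBandit.d (μ k) (μ one)).toReal
                - (OneBitBandit.d (μ k + (μ one - μ k) / OneBitBandit.C n)
                    (μ one - (μ one - μ k) / OneBitBandit.C n)).toReal
              ≤ (μ one - μ k) ^ 2 / OneBitBandit.C n
                  * (1 / μ k + 1 / (1 - μ one)) ^ 2 := by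
  open OneBitBandit in
  refine ⟨642, by norm_num, ?_⟩
  intro K hK Ω _ P _ ν X μ πa one two last hone htwo hlast hν hν1 hX hmap hind hmean hanti hgap
    hpos hlt hπ n hn
  have hb : ∀ k i, ∀ᵐ ω ∂P, X k i ω ∈ Set.Icc (0 : ℝ) 1 := by
    intro k i
    have := hν k
    have h1 : ∀ᵐ x ∂(P.map (X k i)), x ∈ Set.Icc (0 : ℝ) 1 := by
      rw [hmap]
      exact (mem_ae_iff_prob_eq_one measurableSet_Icc).2 (hν1 k)
    exact ae_of_ae_map (hX k i).aemeasurable h1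
  have hmeanX : ∀ k i, ∫ ω, X k i ω ∂P = μ k := by
    intro k i
    rw [hmean, ← hmap k i, integral_map (hX k i).aemeasurable (by fun_prop)]
  have hle_one : ∀ k, μ k ≤ μ one := fun k => hanti (by rw [hone]; exact Fin.mk_le_of_le_val (by omega))
  have hle_two : ∀ k, k ≠ one → μ k ≤ μ two := by
    intro k hk
    apply hanti
    rw [htwo]
    refine Fin.mk_le_of_le_val ?_
    rw [hone] at hk
    have : k.val ≠ 0 := fun h => hk (Fin.ext h)
    omega
  have hlast_le : ∀ k, μ last ≤ μ k := by
    intro k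
    apply hanti
    rw [hlast]
    exact Fin.mk_le_mk.2 (by omega)
  have hk0 : ∀ k, 0 < μ k := fun k => hpos.trans_le (hlast_le k)
  have hkgap : ∀ k, k ≠ one → μ k < μ one := fun k hk => (hle_two k hk).trans_lt hgap
  have hdk : ∀ k, (d (μ k) (μ one)).toReal = kl (μ k) (μ one) := fun k => by
    rw [d_eq_kl _ (hk0 one) hlt, EReal.toReal_coe]
  have hw := rpow_log_ge hn
  have hC2 : 2.88 ≤ C n := by unfold C; linarith
  have hC0 : 0 < C n := by linarith
  refine ⟨?_, ?_, ?_⟩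
  · rw [regret_eq hX μ πa hle_one]
    refine Finset.sum_le_sum fun k hk => ?_
    have hk1 : k ≠ one := (Finset.mem_erase.1 hk).1
    have hg := hkgap k hk1
    obtain ⟨hU0, hbound⟩ := gap_mul_pulls_bound_le (hk0 k) hg hlt hn rfl rfl
    rw [hdk]
    refine le_trans ?_ hbound
    have hD0 : 0 < μ one - μ k := by linarith
    set ε : ℝ := (μ one - μ k) / C n with hε
    have hε0 : 0 < ε := by positivity
    have hε2 : ε * 2 < μ one - μ k := by
      have : ε * C n = μ one - μ k := by rw [hε]; field_simp
      nlinarith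
    have e2 : μ k + 2 * (ε / 2) = μ k + ε := by ring
    -- Half of `ε` goes to sampling error and half to rounding, so the divergence is evaluated with
    -- both means shifted by `ε`.
    have h := integral_pulls_le hK hX hb hind hmeanX hπ one k (δ := ε / 2) (y := μ one - ε)
      (by positivity) (hk0 k).le (by linarith) (by linarith) hlt (n := n) rfl
      (by rw [e2]; exact hU0)
    rw [e2] at h
    refine (mul_le_mul_of_nonneg_left h hD0.le).trans (le_of_eq ?_)
    congr 1
    have e3 : 1 / (ε / 2) = 2 / ε := by field_simp
    have e4 : 1 / (ε / 2) ^ 2 = 4 / ε ^ 2 := by field_simp; norm_num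
    have e5 : μ one - (μ one - ε) = ε := by ring
    rw [e3, e4, e5]
  · rw [abs_of_nonneg (Finset.sum_nonneg fun k hk =>
      lowerOrder_nonneg (hkgap k (Finset.mem_erase.1 hk).1) hn)]
    have hL : 0 ≤ Real.log n ^ (2 / 3 : ℝ) :=
      Real.rpow_nonneg (by linarith [log_ge_of_two_le hn]) _
    have h1p : 0 < 1 - μ one := by linarith
    have hg0 : 0 < μ one - μ two := by linarith
    have hterm : ∀ k ∈ Finset.univ.erase one, lowerOrder (μ one) (μ k) n
        ≤ 642 * (1 / μ last + 1 / (1 - μ one)) ^ 2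
          * (Real.log n ^ (2 / 3 : ℝ) / (μ one - μ two)) := by
      intro k hk
      have hk1 : k ≠ one := (Finset.mem_erase.1 hk).1
      refine (lowerOrder_le (hk0 k) (hkgap k hk1) hlt hn).trans ?_
      have := hk0 k
      have := hlast_le k
      have := hle_two k hk1
      have : 0 < μ one - μ k := by linarith
      gcongr
    have hc : ((Finset.univ.erase one).card : ℝ) ≤ K := by
      exact_mod_cast (Finset.card_erase_le).trans (by simp)
    refine (Finset.sum_le_card_nsmul _ _ _ hterm).trans ?_
    rw [nsmul_eq_mul]
    refine (mul_le_mul_of_nonneg_right hc (by positivity)).trans (le_of_eq ?_)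
    ring
  · intro k hk
    have hg := hkgap k hk
    set ε : ℝ := (μ one - μ k) / C n with hε
    have hε0 : 0 < ε := div_pos (by linarith) hC0
    have hεC : ε * C n = μ one - μ k := by rw [hε]; field_simp
    have hε2 : ε * 2 < μ one - μ k := by nlinarith
    have hkk := hk0 k
    rw [hdk, d_eq_kl _ (by linarith) (by linarith), EReal.toReal_coe]
    refine (kl_sub_kl_le hkk hlt hε0.le (by linarith)).trans ?_
    have h1 : 1 ≤ 1 / μ k := by rw [le_div_iff₀ hkk]; linarith
    have h2 : 1 ≤ 1 / (1 - μ one) := by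
      rw [le_div_iff₀ (by linarith)]; linarith [hk0 one]
    set B : ℝ := 1 / μ k + 1 / (1 - μ one)
    -- This upgrades the factor `2 * B` from `kl_sub_kl_le` to `B ^ 2`.
    have hB : 2 ≤ B := by linarith
    have e : 2 * ε * (μ one - μ k) * B = (μ one - μ k) ^ 2 / C n * (2 * B) := by
      rw [hε]; ring
    rw [e]
    gcongr
    nlinarith
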